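/- **Theorem.** Let $\operatorname{Sym}^n(\mathbb C)=\mathbb C^n/S_n$ with the quotient topology. A point is an unordered $n$-tuple $\mathbf z=\{z_1,\dots,z_n\}$ of complex numbers, repetitions allowed. An *ordered partition* of $m$ is a finite sequence of positive integers with sum $m$. A *stratification* of a space is a locally finite partition into non-empty, locally closed subsets (strata), each locally homeomorphic to some $\mathbb R^d$, such that the closure of each stratum is a union of strata. A partition $\mathcal S$ *refines* a partition $\mathcal T$ (is finer, and $\mathcal T$ is coarser) if each member of $\mathcal S$ lies in a member of $\mathcal T$. Consider the following decompositions of $\operatorname{Sym}^n(\mathbb C)$. * $\mathcal S_{\mathbb C}$: for an unordered partition $\lambda$ of $n$, the stratum $X^{\mathbb C}_\lambda$ is the set of $\mathbf z$ whose distinct points have multiplicities forming $\lambda$. * $\mathcal S^{\rm cont}$: a *contingency matrix* of weight $n$ and size $p\times q$ is a family $M=\|m_{ij}\|_{i=1,\dots,p}^{j=1,\dots,q}$ of non-negative integers with sum $n$ such that for each $i$ some $m_{ij}\ne0$ and for each $j$ some $m_{ij}\neq 0$. If $x_1<\dots<x_p$ are the distinct real parts and $y_1<\dots<y_q$ the distinct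 imaginary parts of the points of $\mathbf z$, let $\mu_{ij}(\mathbf z)=|\{\nu:\operatorname{Re} z_\nu=x_i,\ \operatorname{Im} z_\nu=y_j\}|$. The *contingency cell* $X_M^{\rm cont}$ is $\{\mathbf z:\mu(\mathbf z)=M\}$. * $\mathcal S^{\rm FNF}$: for an ordered partition $\beta=(\beta_1,\dots,\beta_q)$ of $n$ and ordered partitions $\gamma^{(j)}=(\gamma^{(j)}_1,\dots,\gamma^{(j)}_{p_j})$ of $\beta_j$, the Fox–Neuwirth–Fuchs cell $X_{[\beta:\gamma]}$ is the set of $\mathbf z$ whose distinct imaginary parts are $y_1<\dots<y_q$, attained $\beta_1,\dots,\beta_q$ times respectively, and such that for each $j$ the distinct real parts, in increasing order, of the points $z_\nu$ with $\operatorname{Im}z_\nu=y_j$ are attained $\gamma^{(j)}_1,\dots,\gamma^{(j)}_{p_j}$ times on that line. * $i\mathcal S^{\rm FNF}$: the images of the cells of $\mathcal S^{\rm FNF}$ under the automorphism of $\operatorname{Sym}^n(\mathbb C)$ induced by multiplication by $i$. The *horizontal contraction* $\partial'_k$ of $M$ adds the entries with $i=k+1$ to those with $i=k+2$ ($0\le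 k\le p-2$); the *vertical contraction* $\partial''_k$ adds the entries with $j=k+1$ to those with $j=k+2$ ($0\le k\le q-2$). A contraction $N$ of $M$ is *anodyne* if $X^{\rm cont}_N$ and $X^{\rm cont}_M$ lie in the same stratum of $\mathcal S_{\mathbb C}$. All four decompositions are stratifications, and: (a) $\mathcal S^{\rm cont}$ is the coarsest stratification with connected strata that refines both $\mathcal S^{\rm FNF}$ and $i\mathcal S^{\rm FNF}$. That is, its strata are connected, it refines both, and every stratification with connected strata that refines both (indeed every partition into connected subsets that refines both) refines $\mathcal S^{\rm cont}$. (b) $\mathcal S_{\mathbb C}$ is the finest stratification of which both $\mathcal S^{\rm FNF}$ and $i\mathcal S^{\rm FNF}$ are refinements. That is, both refine it, and it refines every stratification (indeed every partition) that both refine. (c) Two contingency matrices $M,N$ of weight $n$ are related by the equivalence relation generated by anodyne horizontal contractions if and only if $X^{\rm cont}_M$ and $X^{\rm cont}_N$ lie in the same cell of $\mathcal S^{\rm FNF}$. They are related by the equivalence relation generated by anodyne vertical contractions if and only if $X^{\rm cont}_M$ and $X^{\rm cont}_N$ lie in the same cell of $i\mathcal S^{\rm FNF}$. -/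

import Mathlib

open scoped BigOperators

noncomputable section

namespace SymProd

/-! ### Stratifications of a topological space -/

section Stratification

variable {X : Type*}

/-- `𝒮` is a refinement of `𝒯`: every stratum of `𝒮` lies in a stratum of `𝒯`
(so `𝒮` is finer and `𝒯` is coarser). -/
def Refines (𝒮 𝒯 : Set (Set X)) : Prop :=
  ∀ S ∈ 𝒮, ∃ T ∈ 𝒯, S ⊆ T

/-- The sets `A` and `B` lie in one and the same member of `𝒮`. -/
def LieInSame (𝒮 : Set (Set X)) (A B : Set X) : Prop :=
  ∃ S ∈ 𝒮, A ⊆ S ∧ B ⊆ S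

variable [TopologicalSpace X]

/-- A subset that, with the subspace topology, is locally homeomorphic to `ℝ^d` for some `d`. -/
def IsLocallyEuclidean (S : Set X) : Prop :=
  ∃ d : ℕ, ∀ x : S, ∃ e : OpenPartialHomeomorph S (EuclideanSpace ℝ (Fin d)), x ∈ e.source

/-- A (topological) stratification: a locally finite partition of `X` into non-empty, locally
closed, locally Euclidean subsets such that the closure of a stratum is a union of strata. -/
structure IsStratification (𝒮 : Set (Set X)) : Prop where
  isPartition : Setoid.IsPartition 𝒮
  locallyFinite : LocallyFinite (fun S : 𝒮 => (S : Set X))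
  isLocallyClosed : ∀ S ∈ 𝒮, IsLocallyClosed S
  isLocallyEuclidean : ∀ S ∈ 𝒮, IsLocallyEuclidean S
  frontier : ∀ S ∈ 𝒮, ∀ T ∈ 𝒮, (closure S ∩ T).Nonempty → T ⊆ closure S

/-- All members of `𝒮` are connected. -/
def HasConnectedStrata (𝒮 : Set (Set X)) : Prop :=
  ∀ S ∈ 𝒮, IsConnected S

end Stratification

/-! ### The symmetric product -/

/-- The projection `X^n → Sym^n(X)`. -/
def proj (X : Type*) (n : ℕ) (v : Fin n → X) : Sym X n :=
  ⟨Multiset.map v Finset.univ.val, by simp⟩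

/-- `Sym^n(X)` carries the quotient topology of `X^n`. -/
instance symTopology (X : Type*) [TopologicalSpace X] (n : ℕ) : TopologicalSpace (Sym X n) :=
  TopologicalSpace.coinduced (proj X n) inferInstance

/-! ### The complex stratification -/

/-- The set of `z` with multiplicity partition `l`; `Nat.Partition.ofSym z` is the multiset of
the multiplicities of the distinct points of `z`. -/
def complexStratum {n : ℕ} (l : n.Partition) : Set (Sym ℂ n) :=
  {z | Nat.Partition.ofSym z = l}

/-- The complex stratification of `Sym^n(ℂ)`. -/
def complexStrata (n : ℕ) : Set (Set (Sym ℂ n)) :=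
  {S | ∃ l : n.Partition, S = complexStratum l}

/-! ### Fox–Neuwirth–Fuchs cells -/

/-- The cell `K_β` of `Sym^n(ℝ)`, for an ordered partition `β` of `n`: the divisors
`β₁ y₁ + ⋯ + β_q y_q` with `y₁ < ⋯ < y_q`. -/
def realCell {n : ℕ} (β : Composition n) : Set (Multiset ℝ) :=
  {s | ∃ y : Fin β.length → ℝ, StrictMono y ∧
    s = ∑ j, Multiset.replicate (β.blocksFun j) (y j)}

/-- The cell `X_[β:γ]`, for an ordered partition `β = (β₁, …, β_q)` of `n` and ordered partitions
`γ j` of `β_j`: the imaginary parts form a divisor `β₁ y₁ + ⋯ + β_q y_q` with `y₁ < ⋯ < y_q`,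
and the points on the horizontal line `Im = y_j` form, through their real parts, a point of
the cell of `γ j`. -/
def fnfCell {n : ℕ} (β : Composition n)
    (γ : ∀ j : Fin β.length, Composition (β.blocksFun j)) : Set (Sym ℂ n) :=
  {z | ∃ y : Fin β.length → ℝ, StrictMono y ∧
    (z : Multiset ℂ).map Complex.im = ∑ j, Multiset.replicate (β.blocksFun j) (y j) ∧
    ∀ j, ((z : Multiset ℂ).filter (fun w => w.im = y j)).map Complex.re ∈ realCell (γ j)}

/-- The Fox–Neuwirth–Fuchs decomposition of `Sym^n(ℂ)`. -/
def fnfStrata (n : ℕ) : Set (Set (Sym ℂ n)) :=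
  {S | ∃ (β : Composition n) (γ : ∀ j : Fin β.length, Composition (β.blocksFun j)),
    S = fnfCell β γ}

/-- The dual decomposition: the images of the Fox–Neuwirth–Fuchs cells under the automorphism of
`Sym^n(ℂ)` induced by multiplication by `i`. -/
def ifnfStrata (n : ℕ) : Set (Set (Sym ℂ n)) :=
  {S | ∃ T ∈ fnfStrata n, S = Sym.map (fun w : ℂ => Complex.I * w) '' T}

/-! ### Contingency matrices -/

/-- The set `CM_n(p,q)` of contingency matrices `m i j` (`i < p`, `j < q`) of weight `n`. The index
`i` numbers the columns (it will number the real parts, from left to right) and `j` numbers the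
rows (the imaginary parts, in increasing order). -/
@[ext] structure CM (n p q : ℕ) where
  m : Fin p → Fin q → ℕ
  col_ne : ∀ i, ∃ j, m i j ≠ 0
  row_ne : ∀ j, ∃ i, m i j ≠ 0
  weight : ∑ i, ∑ j, m i j = n

/-- The set `CM_n` of contingency matrices of weight `n`, of all sizes. -/
abbrev CMn (n : ℕ) : Type := Σ p q : ℕ, CM n p q

/-- The horizontal contraction `∂'_i`, which adds up the columns with (0-based) numbers `i` and
`i + 1`; `i.predAbove` is the monotone surjection that takes the value `i` at both of them. -/
def CM.hContract {n p q : ℕ} (M : CM n (p + 1) q) (i : Fin p) : CM n p q where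
  m a j := ∑ k ∈ Finset.univ.filter (fun k => i.predAbove k = a), M.m k j
  col_ne a := by
    obtain ⟨k, hk⟩ : ∃ k, i.predAbove k = a := Fin.predAbove_surjective i a
    obtain ⟨j, hj⟩ := M.col_ne k
    refine ⟨j, fun h => hj ?_⟩
    exact (Finset.sum_eq_zero_iff.mp h) k (by simp [hk])
  row_ne j := by
    obtain ⟨k, hk⟩ := M.row_ne j
    refine ⟨i.predAbove k, fun h => hk ?_⟩
    exact (Finset.sum_eq_zero_iff.mp h) k (by simp)
  weight := by
    rw [Finset.sum_comm]
    simp_rw [Finset.sum_fiberwise]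
    rw [Finset.sum_comm]
    exact M.weight

/-- The vertical contraction `∂''_j`, which adds up the rows with (0-based) numbers `j` and
`j + 1`. -/
def CM.vContract {n p q : ℕ} (M : CM n p (q + 1)) (j : Fin q) : CM n p q where
  m i b := ∑ k ∈ Finset.univ.filter (fun k => j.predAbove k = b), M.m i k
  col_ne i := by
    obtain ⟨k, hk⟩ := M.col_ne i
    refine ⟨j.predAbove k, fun h => hk ?_⟩
    exact (Finset.sum_eq_zero_iff.mp h) k (by simp)
  row_ne b := by
    obtain ⟨k, hk⟩ : ∃ k, j.predAbove k = b := Fin.predAbove_surjective j b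
    obtain ⟨i, hi⟩ := M.row_ne k
    refine ⟨i, fun h => hi ?_⟩
    exact (Finset.sum_eq_zero_iff.mp h) k (by simp [hk])
  weight := by
    simp_rw [Finset.sum_fiberwise]
    exact M.weight

/-! ### Contingency cells -/

theorem sum_countP_and {A B : Type*} [DecidableEq B] {k : ℕ} (s : Multiset A) (f : A → B)
    (P : A → Prop) [DecidablePred P] (e : Fin k → B) (he : Function.Injective e)
    (hs : ∀ a ∈ s, ∃ i, e i = f a) :
    ∑ i, s.countP (fun a => P a ∧ f a = e i) = s.countP P := by
  induction s using Multiset.induction with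
  | empty => simp
  | cons a s ih =>
    have ih' := ih (fun b hb => hs b (Multiset.mem_cons_of_mem hb))
    obtain ⟨i₀, hi₀⟩ := hs a (Multiset.mem_cons_self a s)
    simp only [Multiset.countP_cons, Finset.sum_add_distrib, ih']
    congr 1
    by_cases hP : P a
    · simp [hP, ← hi₀, he.eq_iff]
    · simp [hP]

/-- The distinct real parts of the points of `z`. -/
def reValues {n : ℕ} (z : Sym ℂ n) : Finset ℝ := ((z : Multiset ℂ).map Complex.re).toFinset

/-- The distinct imaginary parts of the points of `z`. -/
def imValues {n : ℕ} (z : Sym ℂ n) : Finset ℝ := ((z : Multiset ℂ).map Complex.im).toFinset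

/-- The real parts `x₁ < ⋯ < x_p` of the points of `z`, in increasing order. -/
def xs {n : ℕ} (z : Sym ℂ n) : Fin (reValues z).card ↪o ℝ := (reValues z).orderEmbOfFin rfl

/-- The imaginary parts `y₁ < ⋯ < y_q` of the points of `z`, in increasing order. -/
def ys {n : ℕ} (z : Sym ℂ n) : Fin (imValues z).card ↪o ℝ := (imValues z).orderEmbOfFin rfl

theorem exists_xs {n : ℕ} (z : Sym ℂ n) {w : ℂ} (hw : w ∈ (z : Multiset ℂ)) :
    ∃ i, xs z i = w.re := by
  have h : w.re ∈ Set.range (xs z) := by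
    rw [xs, Finset.range_orderEmbOfFin]
    simpa [reValues] using ⟨w, hw, rfl⟩
  exact h

theorem exists_ys {n : ℕ} (z : Sym ℂ n) {w : ℂ} (hw : w ∈ (z : Multiset ℂ)) :
    ∃ j, ys z j = w.im := by
  have h : w.im ∈ Set.range (ys z) := by
    rw [ys, Finset.range_orderEmbOfFin]
    simpa [imValues] using ⟨w, hw, rfl⟩
  exact h

/-- The contingency matrix `μ(z)`: its entry `(i, j)` is the number of points of `z` (with
multiplicities) that have real part `x_i` and imaginary part `y_j`. -/
def contMatrix {n : ℕ} (z : Sym ℂ n) : CM n (reValues z).card (imValues z).card where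
  m i j := (z : Multiset ℂ).countP (fun w => w.re = xs z i ∧ w.im = ys z j)
  col_ne i := by
    have h : xs z i ∈ reValues z := Finset.orderEmbOfFin_mem _ _ _
    obtain ⟨w, hw, hwi⟩ : ∃ w ∈ (z : Multiset ℂ), w.re = xs z i := by
      simpa [reValues] using h
    obtain ⟨j, hj⟩ := exists_ys z hw
    exact ⟨j, (Multiset.countP_pos_of_mem hw ⟨hwi, hj.symm⟩).ne'⟩
  row_ne j := by
    have h : ys z j ∈ imValues z := Finset.orderEmbOfFin_mem _ _ _
    obtain ⟨w, hw, hwj⟩ : ∃ w ∈ (z : Multiset ℂ), w.im = ys z j := by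
      simpa [imValues] using h
    obtain ⟨i, hi⟩ := exists_xs z hw
    exact ⟨i, (Multiset.countP_pos_of_mem hw ⟨hi.symm, hwj⟩).ne'⟩
  weight := by
    have h1 : ∀ i, ∑ j, (z : Multiset ℂ).countP (fun w => w.re = xs z i ∧ w.im = ys z j)
        = (z : Multiset ℂ).countP (fun w => True ∧ w.re = xs z i) := fun i => by
      rw [sum_countP_and (z : Multiset ℂ) Complex.im (fun w => w.re = xs z i) (ys z)
        (ys z).injective (fun a ha => exists_ys z ha)]
      simp
    rw [Finset.sum_congr rfl (fun i _ => h1 i),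
      sum_countP_and (z : Multiset ℂ) Complex.re (fun _ => True) (xs z)
        (xs z).injective (fun a ha => exists_xs z ha)]
    simp

/-- The matrix `μ(z)` as an element of `CM_n`. -/
def contMap {n : ℕ} (z : Sym ℂ n) : CMn n := ⟨_, _, contMatrix z⟩

/-- The contingency cell of `M`: the set of `z` with `μ(z) = M`. -/
def contCell {n : ℕ} (M : CMn n) : Set (Sym ℂ n) := {z | contMap z = M}

/-- The contingency cell decomposition of `Sym^n(ℂ)`. -/
def contStrata (n : ℕ) : Set (Set (Sym ℂ n)) := {S | ∃ M : CMn n, S = contCell M}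

/-! ### Anodyne contractions -/

/-- `HorAnodyne M N`: the matrix `N` is a horizontal contraction `∂'_i M` which is anodyne for `M`,
i.e. the cells of `M` and `∂'_i M` lie in the same complex stratum. -/
inductive HorAnodyne {n : ℕ} : CMn n → CMn n → Prop
  | intro {p q : ℕ} (M : CM n (p + 1) q) (i : Fin p)
      (h : LieInSame (complexStrata n) (contCell ⟨p + 1, q, M⟩) (contCell ⟨p, q, M.hContract i⟩)) :
      HorAnodyne ⟨p + 1, q, M⟩ ⟨p, q, M.hContract i⟩

/-- `VertAnodyne M N`: the matrix `N` is a vertical contraction `∂''_j M` which is anodyne for `M`,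
i.e. the cells of `M` and `∂''_j M` lie in the same complex stratum. -/
inductive VertAnodyne {n : ℕ} : CMn n → CMn n → Prop
  | intro {p q : ℕ} (M : CM n p (q + 1)) (j : Fin q)
      (h : LieInSame (complexStrata n) (contCell ⟨p, q + 1, M⟩) (contCell ⟨p, q, M.vContract j⟩)) :
      VertAnodyne ⟨p, q + 1, M⟩ ⟨p, q, M.vContract j⟩

end SymProd

end

open SymProd

/-! ### The quotient map onto the symmetric product -/

namespace SymProd

open Topology Filter

/-! All four decompositions arise in one way. Split `ℂ` into finitely many classes and record, for a
vector `v`, the classes of all differences `v i - v j`; this is its code. Vectors with equal code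
form a face, and the strata are the images of the faces in the symmetric product. The complex strata
come from zero versus non-zero, the contingency cells from the signs of `re` and `im`, the
Fox–Neuwirth–Fuchs cells from the sign of `im` with ties broken by `re`, and the dual cells from the
same with the roles exchanged. `DiffSign` isolates what is needed of the classes. Each face is open
in a linear subspace and its closure is described by codes; since `proj` is an open quotient map by
a finite group, `DiffSign.isStratification_strata` handles all four cases at once.

For (a), the number of pairs with distinct imaginary parts is constant on a Fox–Neuwirth–Fuchs cell,
and the number with distinct real parts on a dual cell. Their sum is the rank of the contingency
code (`totalRank_contSign`). Near a point this rank cannot drop, and it stays equal only if the code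
does. So the contingency matrix is locally constant, hence constant, on a connected set inside one
cell of each kind.

For (b), a shear `re + t * im` stays in the Fox–Neuwirth–Fuchs cell and, for generic `t`, separates
the real parts of distinct points. The imaginary parts can then be changed freely inside the dual
cell. A few such moves join any two configurations with the same coincidences
(`rel_of_zeroSign_code_eq`).

For (c), an anodyne horizontal contraction merges columns but no points, so the order within each
row is unchanged. Conversely, a Fox–Neuwirth–Fuchs face is convex, hence connected, and near a point
of it the columns can only split. Undoing a splitting is a monotone merging of columns, a chain of
elementary anodyne contractions (`eqvGen_horAnodyne_comp`). Transposition gives the vertical case.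
-/

theorem proj_comp_perm {X : Type*} {n : ℕ} (v : Fin n → X) (σ : Equiv.Perm (Fin n)) :
    proj X n (v ∘ σ) = proj X n v := by
  apply Subtype.ext
  change Multiset.map (v ∘ σ) Finset.univ.val = Multiset.map v Finset.univ.val
  rw [← Multiset.map_map, Multiset.map_univ_val_equiv]

theorem coe_proj {X : Type*} {n : ℕ} (v : Fin n → X) :
    ((proj X n v : Sym X n) : Multiset X) = Multiset.map v Finset.univ.val := rfl

/-- Equal multisets have fibres of equal size over every value, and bijections of the fibres glue.
-/
theorem exists_equiv_of_map_eq {ι ι' X : Type*} [Fintype ι] [Fintype ι'] {v : ι → X} {w : ι' → X}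
    (h : Multiset.map v Finset.univ.val = Multiset.map w Finset.univ.val) :
    ∃ σ : ι' ≃ ι, w = v ∘ σ := by
  classical
  have hc : ∀ x, Nonempty ({i // w i = x} ≃ {i // v i = x}) := fun x => by
    refine ⟨Fintype.equivOfCardEq ?_⟩
    have := congrArg (Multiset.count x) h
    rw [Multiset.count_map, Multiset.count_map] at this
    rw [Fintype.card_subtype, Fintype.card_subtype]
    simp only [eq_comm (b := x)] at this ⊢
    exact this.symm
  refine ⟨(Equiv.sigmaFiberEquiv w).symm.trans
    ((Equiv.sigmaCongrRight fun x => (hc x).some).trans (Equiv.sigmaFiberEquiv v)), ?_⟩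
  funext i
  exact ((hc (w i)).some ⟨i, rfl⟩).2.symm

theorem proj_eq_iff {X : Type*} {n : ℕ} {v w : Fin n → X} :
    proj X n v = proj X n w ↔ ∃ σ : Equiv.Perm (Fin n), w = v ∘ σ := by
  constructor
  · intro h
    exact exists_equiv_of_map_eq (congrArg (fun z : Sym X n => (z : Multiset X)) h)
  · rintro ⟨σ, rfl⟩
    exact (proj_comp_perm v σ).symm

theorem exists_map_univ_eq {X : Type*} {n : ℕ} {s : Multiset X} (hs : Multiset.card s = n) :
    ∃ v : Fin n → X, Multiset.map v Finset.univ.val = s := by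
  induction s using Quotient.inductionOn with
  | h l =>
    subst hs
    refine ⟨fun i => l.get i, ?_⟩
    rw [Fin.univ_def]
    simp [Multiset.map_coe]

theorem proj_surjective (X : Type*) (n : ℕ) : Function.Surjective (proj X n) := fun z => by
  obtain ⟨v, hv⟩ := exists_map_univ_eq z.2
  exact ⟨v, Subtype.ext hv⟩

theorem map_proj {X Y : Type*} {n : ℕ} (f : X → Y) (v : Fin n → X) :
    Sym.map f (proj X n v) = proj Y n (f ∘ v) := by
  apply Subtype.ext
  change Multiset.map f (Multiset.map v Finset.univ.val) = _
  rw [Multiset.map_map]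
  rfl

theorem continuous_proj (X : Type*) [TopologicalSpace X] (n : ℕ) : Continuous (proj X n) :=
  continuous_coinduced_rng

theorem isQuotientMap_proj (X : Type*) [TopologicalSpace X] (n : ℕ) :
    IsQuotientMap (proj X n) := ⟨⟨rfl⟩, proj_surjective X n⟩

theorem preimage_image_proj {X : Type*} {n : ℕ} (U : Set (Fin n → X)) :
    proj X n ⁻¹' (proj X n '' U) =
      ⋃ σ : Equiv.Perm (Fin n), (fun v : Fin n → X => v ∘ σ) ⁻¹' U := by
  ext v
  simp only [Set.mem_preimage, Set.mem_image, Set.mem_iUnion]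
  constructor
  · rintro ⟨u, hu, h⟩
    obtain ⟨σ, rfl⟩ := proj_eq_iff.1 h
    have h1 : (u ∘ σ) ∘ (σ⁻¹ : Equiv.Perm (Fin n)) = u := by ext i; simp
    exact ⟨σ⁻¹, h1.symm ▸ hu⟩
  · rintro ⟨σ, hσ⟩
    exact ⟨v ∘ σ, hσ, proj_comp_perm v σ⟩

/-- The saturation of an open set is the union of its translates by permutations, each of them open.
-/
theorem isOpenMap_proj (X : Type*) [TopologicalSpace X] (n : ℕ) : IsOpenMap (proj X n) := by
  intro U hU
  rw [← (isQuotientMap_proj X n).isOpen_preimage, preimage_image_proj]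
  exact isOpen_iUnion fun σ => hU.preimage (by fun_prop)

theorem nhds_proj {X : Type*} [TopologicalSpace X] {n : ℕ} (v : Fin n → X) :
    𝓝 (proj X n v) = map (proj X n) (𝓝 v) :=
  ((isOpenMap_proj X n).map_nhds_eq (continuous_proj X n).continuousAt).symm

end SymProd

/-! ### Stratifications of the symmetric product given by the signs of differences -/

namespace SymProd

open Topology Filter

/-- A decomposition of `ℂ` into finitely many pieces `sgn ⁻¹' {k}`, each of them open in a real
subspace `span k`; `degen k l` says that the piece of `l` lies in the closure of that of `k`. -/
structure DiffSign (K : Type*) where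
  sgn : ℂ → K
  span : K → Submodule ℝ ℂ
  rank : K → ℕ
  degen : K → K → Prop
  eq_zero : ∀ w, sgn w = sgn 0 → w = 0
  mem_span : ∀ w, w ∈ span (sgn w)
  -- Besides openness of a class in its span, this says that the rank cannot drop locally and that
  -- every local change of sign raises it.
  near : ∀ w, ∀ᶠ w' in 𝓝 w, (w' ∈ span (sgn w) → sgn w' = sgn w) ∧
    rank (sgn w) ≤ rank (sgn w') ∧ (rank (sgn w') = rank (sgn w) → sgn w' = sgn w)
  degen_refl : ∀ k, degen k k
  isClosed_degen : ∀ k, IsClosed {w | degen k (sgn w)}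
  approach : ∀ u w, degen (sgn u) (sgn w) →
    ∀ᶠ t : ℝ in 𝓝[>] 0, sgn (w + t • (u - w)) = sgn u

namespace DiffSign

variable {K : Type*} (s : DiffSign K) {n : ℕ}

/-- The signs of all the differences of the entries of `v`. -/
def code (v : Fin n → ℂ) (i j : Fin n) : K := s.sgn (v i - v j)

/-- The vectors with the same code as `v`. -/
def face (v : Fin n → ℂ) : Set (Fin n → ℂ) := {v' | s.code v' = s.code v}

/-- The image of a face in the symmetric product. -/
def stratum (v : Fin n → ℂ) : Set (Sym ℂ n) := proj ℂ n '' s.face v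

variable (n) in
/-- The decomposition of the symmetric product into the images of the faces. -/
def strata : Set (Set (Sym ℂ n)) := Set.range (s.stratum (n := n))

/-- The real subspace in which the face of `v` is open. -/
def faceSpan (v : Fin n → ℂ) : Submodule ℝ (Fin n → ℂ) where
  carrier := {v' | ∀ i j, v' i - v' j ∈ s.span (s.code v i j)}
  add_mem' {a b} ha hb i j := by
    have : (a + b) i - (a + b) j = (a i - a j) + (b i - b j) := by simp only [Pi.add_apply]; ring
    rw [this]
    exact add_mem (ha i j) (hb i j)
  zero_mem' i j := by simp
  smul_mem' c a ha i j := by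
    have : (c • a) i - (c • a) j = c • (a i - a j) := by simp only [Pi.smul_apply, smul_sub]
    rw [this]
    exact Submodule.smul_mem _ c (ha i j)

/-- The sum of the ranks of the signs of all differences. -/
def totalRank (v : Fin n → ℂ) : ℕ := ∑ i, ∑ j, s.rank (s.code v i j)

/-! ### Codes and strata under permutations of the coordinates -/

variable {s}

theorem code_comp (v : Fin n → ℂ) (σ : Fin n → Fin n) :
    s.code (v ∘ σ) = fun i j => s.code v (σ i) (σ j) := rfl

theorem code_comp_congr {v w : Fin n → ℂ} (h : s.code v = s.code w) (σ : Fin n → Fin n) :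
    s.code (v ∘ σ) = s.code (w ∘ σ) := by
  rw [code_comp, code_comp, h]

theorem eq_iff_of_code_eq {v w : Fin n → ℂ} (h : s.code v = s.code w) (i j : Fin n) :
    v i = v j ↔ w i = w j := by
  have key : ∀ {v w : Fin n → ℂ}, s.code v = s.code w → v i = v j → w i = w j := by
    intro v w h hv
    have h1 : s.sgn (v i - v j) = s.sgn (w i - w j) := congrFun (congrFun h i) j
    rw [hv, sub_self] at h1
    exact sub_eq_zero.1 (s.eq_zero _ h1.symm)
  exact ⟨key h, key h.symm⟩

/-- Such sums do not depend on the ordering of the points, so they are numerical invariants of the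
strata. -/
theorem sum_code_comp_perm (φ : K → ℕ) (v : Fin n → ℂ) (σ : Equiv.Perm (Fin n)) :
    ∑ i, ∑ j, φ (s.code (v ∘ σ) i j) = ∑ i, ∑ j, φ (s.code v i j) := by
  rw [code_comp]
  rw [Equiv.sum_comp σ (fun i => ∑ j, φ (s.code v i (σ j)))]
  exact Finset.sum_congr rfl fun i _ => Equiv.sum_comp σ (fun j => φ (s.code v i j))

theorem proj_mem_stratum {v w : Fin n → ℂ} :
    proj ℂ n w ∈ s.stratum v ↔ ∃ σ : Equiv.Perm (Fin n), s.code (w ∘ σ) = s.code v := by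
  constructor
  · rintro ⟨u, hu, h⟩
    obtain ⟨σ, rfl⟩ := proj_eq_iff.1 h.symm
    exact ⟨σ, hu⟩
  · rintro ⟨σ, hσ⟩
    exact ⟨w ∘ σ, hσ, proj_comp_perm w σ⟩

theorem proj_mem_stratum_self (v : Fin n → ℂ) : proj ℂ n v ∈ s.stratum v :=
  ⟨v, rfl, rfl⟩

theorem stratum_congr {v w : Fin n → ℂ} (h : s.code v = s.code w) :
    s.stratum v = s.stratum w := by
  unfold stratum face
  rw [h]

theorem stratum_comp_perm (v : Fin n → ℂ) (σ : Equiv.Perm (Fin n)) :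
    s.stratum (v ∘ σ) = s.stratum v := by
  have key : ∀ (v : Fin n → ℂ) (σ : Equiv.Perm (Fin n)), s.stratum (v ∘ σ) ⊆ s.stratum v := by
    rintro v σ _ ⟨w, hw, rfl⟩
    refine proj_mem_stratum.2 ⟨σ⁻¹, ?_⟩
    have h1 : (v ∘ σ) ∘ (σ⁻¹ : Equiv.Perm (Fin n)) = v := by ext i; simp
    rw [code_comp_congr hw, h1]
  refine (key v σ).antisymm ?_
  have h1 : (v ∘ σ) ∘ (σ⁻¹ : Equiv.Perm (Fin n)) = v := by ext i; simp
  conv_lhs => rw [← h1]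
  exact key _ _

theorem stratum_eq_of_mem {v w : Fin n → ℂ} (h : proj ℂ n w ∈ s.stratum v) :
    s.stratum w = s.stratum v := by
  obtain ⟨σ, hσ⟩ := proj_mem_stratum.1 h
  rw [← stratum_comp_perm w σ, stratum_congr hσ]

theorem sum_code_eq_of_mem_stratum (φ : K → ℕ) {v w : Fin n → ℂ}
    (h : proj ℂ n w ∈ s.stratum v) :
    ∑ i, ∑ j, φ (s.code w i j) = ∑ i, ∑ j, φ (s.code v i j) := by
  obtain ⟨σ, hσ⟩ := proj_mem_stratum.1 h
  rw [← sum_code_comp_perm φ w σ, hσ]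

theorem isPartition_strata : Setoid.IsPartition (s.strata n) := by
  constructor
  · rintro ⟨v, hv⟩
    exact (Set.eq_empty_iff_forall_notMem.1 hv) _ (proj_mem_stratum_self v)
  · intro z
    obtain ⟨v, rfl⟩ := proj_surjective ℂ n z
    refine ⟨s.stratum v, ⟨⟨v, rfl⟩, proj_mem_stratum_self v⟩, ?_⟩
    rintro _ ⟨⟨w, rfl⟩, hw⟩
    exact (stratum_eq_of_mem hw).symm

theorem finite_strata [Finite K] : (s.strata n).Finite := by
  have h : s.strata n ⊆ Set.range fun c : Fin n → Fin n → K =>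
      proj ℂ n '' {v | s.code v = c} := by
    rintro _ ⟨v, rfl⟩
    exact ⟨s.code v, rfl⟩
  exact (Set.finite_range _).subset h

/-- Each rank is locally at least its value at `v`, so equality of the sums forces equality term by
term, and equal ranks force equal signs. -/
theorem eventually_near (v : Fin n → ℂ) : ∀ᶠ w in 𝓝 v,
    (w ∈ s.faceSpan v → s.code w = s.code v) ∧
      (s.totalRank w = s.totalRank v → s.code w = s.code v) := by
  have h : ∀ᶠ w : Fin n → ℂ in 𝓝 v, ∀ i j,
      (w i - w j ∈ s.span (s.code v i j) → s.code w i j = s.code v i j) ∧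
      s.rank (s.code v i j) ≤ s.rank (s.code w i j) ∧
      (s.rank (s.code w i j) = s.rank (s.code v i j) → s.code w i j = s.code v i j) := by
    refine eventually_all.2 fun i => eventually_all.2 fun j => ?_
    have hc : Tendsto (fun w : Fin n → ℂ => w i - w j) (𝓝 v) (𝓝 (v i - v j)) :=
      Continuous.tendsto (by fun_prop) v
    exact hc.eventually (s.near (v i - v j))
  filter_upwards [h] with w hw
  refine ⟨fun hwv => funext fun i => funext fun j => (hw i j).1 (hwv i j), fun hr => ?_⟩
  have h1 := (Finset.sum_eq_sum_iff_of_le (s := Finset.univ) (fun i _ =>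
    Finset.sum_le_sum fun j _ => (hw i j).2.1)).1 hr.symm
  funext i j
  have h2 := (Finset.sum_eq_sum_iff_of_le (s := Finset.univ) (fun j _ => (hw i j).2.1)).1
    (h1 i (Finset.mem_univ i))
  exact (hw i j).2.2 (h2 j (Finset.mem_univ j)).symm

theorem mem_faceSpan {v w : Fin n → ℂ} (h : s.code w = s.code v) : w ∈ s.faceSpan v := by
  intro i j
  rw [← h]
  exact s.mem_span _

/-- Near a point, the preimage of a stratum, the face and its span agree, and the projection is
injective on the face. -/
theorem exists_nhds_face (v : Fin n → ℂ) : ∃ U : Set (Fin n → ℂ), IsOpen U ∧ v ∈ U ∧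
    (∀ w ∈ U, w ∈ s.faceSpan v → s.code w = s.code v) ∧
    (∀ w ∈ U, proj ℂ n w ∈ s.stratum v → s.code w = s.code v) ∧
    (∀ w ∈ U, ∀ w' ∈ U, s.code w = s.code v → proj ℂ n w = proj ℂ n w' → w = w') := by
  have hsep : ∀ᶠ p : (Fin n → ℂ) × (Fin n → ℂ) in 𝓝 (v, v), ∀ i j, v i ≠ v j →
      p.1 i ≠ p.2 j := by
    refine eventually_all.2 fun i => eventually_all.2 fun j => ?_
    by_cases hij : v i = v j
    · simp [hij]
    · have hc : ContinuousAt (fun p : (Fin n → ℂ) × (Fin n → ℂ) => p.1 i - p.2 j) (v, v) :=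
        Continuous.continuousAt (by fun_prop)
      filter_upwards [hc.eventually_ne (sub_ne_zero.2 hij)] with p hp _
      exact sub_ne_zero.1 hp
  rw [nhds_prod_eq] at hsep
  obtain ⟨U₁, hU₁, hsep⟩ := (eventually_prod_self_iff (r := fun a b : Fin n → ℂ => ∀ i j, v i ≠ v j → a i ≠ b j)).1 hsep
  obtain ⟨U, hU, hUo, hvU⟩ := mem_nhds_iff.1 (inter_mem hU₁ (eventually_near (s := s) v))
  refine ⟨U, hUo, hvU, fun w hw => (hU hw).2.1,
    fun w hw h => (hU hw).2.2 (sum_code_eq_of_mem_stratum s.rank h), ?_⟩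
  intro w hw w' hw' hc hp
  obtain ⟨σ, rfl⟩ := proj_eq_iff.1 hp
  funext i
  -- Entries that are distinct in `v` stay separated across any two vectors of the neighbourhood,
  -- while `w (σ i)` is entry `i` of the second vector. So `σ` only permutes coinciding entries of
  -- `v`, and these also coincide in `w`.
  have h1 : v (σ i) = v i := by
    by_contra h
    exact hsep w (hU hw).1 (w ∘ σ) (hU hw').1 (σ i) i h rfl
  exact ((eq_iff_of_code_eq hc (σ i) i).2 h1).symm

/-- Local closedness is openness of the coborder, and coborders commute with preimages under an open
continuous map. Upstairs, near each of its points the preimage of the stratum is a linear subspace.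
-/
theorem isLocallyClosed_stratum (v : Fin n → ℂ) : IsLocallyClosed (s.stratum v) := by
  rw [isLocallyClosed_iff_isOpen_coborder, ← (isQuotientMap_proj ℂ n).isOpen_preimage,
    ← coborder_preimage (isOpenMap_proj ℂ n) (continuous_proj ℂ n),
    ← isLocallyClosed_iff_isOpen_coborder]
  refine ((isLocallyClosed_tfae _).out 0 2).2 ?_
  intro w hw
  have hs : s.stratum w = s.stratum v := stratum_eq_of_mem hw
  obtain ⟨U, hU, hwU, h1, h2, -⟩ := exists_nhds_face (s := s) w
  refine ⟨U, hU.mem_nhds hwU, ?_⟩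
  have h : (Subtype.val ⁻¹' (proj ℂ n ⁻¹' s.stratum v) : Set U) =
      Subtype.val ⁻¹' (s.faceSpan w : Set (Fin n → ℂ)) := by
    ext ⟨u, hu⟩
    simp only [Set.mem_preimage, SetLike.mem_coe]
    rw [← hs]
    refine ⟨fun h => mem_faceSpan (h2 u hu h), fun h => ?_⟩
    rw [← stratum_congr (h1 u hu h)]
    exact proj_mem_stratum_self u
  rw [h]
  exact (Submodule.closed_of_finiteDimensional _).preimage continuous_subtype_val

/-- Near a point of the face, `proj` restricts to an open embedding of an open piece of `faceSpan`
into the stratum; its inverse is the chart. -/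
theorem isLocallyEuclidean_stratum (v : Fin n → ℂ) : IsLocallyEuclidean (s.stratum v) := by
  refine ⟨Module.finrank ℝ (s.faceSpan v), ?_⟩
  rintro ⟨_, w, hw, rfl⟩
  have hsp : s.faceSpan w = s.faceSpan v := by
    ext u
    change (∀ i j, _) ↔ (∀ i j, _)
    rw [show s.code w = s.code v from hw]
  obtain ⟨U, hU, hwU, h1, h2, h3⟩ := exists_nhds_face (s := s) w
  have hs : s.stratum w = s.stratum v := stratum_congr hw
  rw [hsp] at h1
  rw [hs] at h2
  let O : TopologicalSpace.Opens (s.faceSpan v) :=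
    ⟨Subtype.val ⁻¹' U, hU.preimage continuous_subtype_val⟩
  have hO : ∀ x : O, s.code (x : s.faceSpan v).1 = s.code w := fun x => h1 _ x.2 x.1.2
  let g : O → s.stratum v := fun x => ⟨proj ℂ n (x : s.faceSpan v).1, _, (hO x).trans hw, rfl⟩
  have hg : Continuous g := Continuous.subtype_mk
    ((continuous_proj ℂ n).comp (continuous_subtype_val.comp continuous_subtype_val)) _
  have hinj : Function.Injective g := by
    intro x y hxy
    have := h3 _ x.2 _ y.2 (hO x) (congrArg Subtype.val hxy)
    exact Subtype.ext (Subtype.ext this)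
  have hopen : IsOpenMap g := by
    intro W hW
    obtain ⟨W₁, hW₁, rfl⟩ := isOpen_induced_iff.1 hW
    obtain ⟨W₂, hW₂, rfl⟩ := isOpen_induced_iff.1 hW₁
    refine isOpen_induced_iff.2 ⟨proj ℂ n '' (W₂ ∩ U), isOpenMap_proj ℂ n _ (hW₂.inter hU), ?_⟩
    ext ⟨z, hz⟩
    simp only [Set.mem_preimage, Set.mem_image]
    constructor
    · rintro ⟨u, ⟨huW, huU⟩, rfl⟩
      have hu : u ∈ s.faceSpan v := mem_faceSpan ((h2 u huU hz).trans hw)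
      exact ⟨⟨⟨u, hu⟩, huU⟩, huW, rfl⟩
    · rintro ⟨x, hx, hxz⟩
      exact ⟨x.1.1, ⟨hx, x.2⟩, congrArg Subtype.val hxz⟩
  have hemb : IsOpenEmbedding g := .of_continuous_injective_isOpenMap hg hinj hopen
  let x₀ : O := ⟨⟨w, mem_faceSpan hw⟩, hwU⟩
  have : Nonempty O := ⟨x₀⟩
  refine ⟨(hemb.toOpenPartialHomeomorph g).symm.trans
    ((O.isOpen.isOpenEmbedding_subtypeVal.toOpenPartialHomeomorph _).trans
      (toEuclidean (E := s.faceSpan v)).toHomeomorph.toOpenPartialHomeomorph), ?_⟩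
  have : (⟨proj ℂ n w, w, hw, rfl⟩ : s.stratum v) = g x₀ := rfl
  simp [this]

/-- The condition on the right is closed. When it holds, the segment from `w` to `v` lies in the
face of `v` just after leaving `w`. -/
theorem mem_closure_face {v w : Fin n → ℂ} :
    w ∈ closure (s.face v) ↔ ∀ i j, s.degen (s.code v i j) (s.code w i j) := by
  constructor
  · intro h
    have hcl : IsClosed {w : Fin n → ℂ | ∀ i j, s.degen (s.code v i j) (s.code w i j)} := by
      simp only [Set.ofPred_forall]
      exact isClosed_iInter fun i => isClosed_iInter fun j =>
        (s.isClosed_degen (s.code v i j)).preimage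
          (f := fun w : Fin n → ℂ => w i - w j) (by fun_prop)
    refine closure_minimal ?_ hcl h
    intro u hu i j
    rw [show s.code u = s.code v from hu]
    exact s.degen_refl _
  · intro h
    have ht : Tendsto (fun t : ℝ => w + t • (v - w)) (𝓝[>] 0) (𝓝 w) := by
      have : Tendsto (fun t : ℝ => w + t • (v - w)) (𝓝 0) (𝓝 (w + (0 : ℝ) • (v - w))) :=
        Continuous.tendsto (by fun_prop) 0
      rw [zero_smul, add_zero] at this
      exact this.mono_left nhdsWithin_le_nhds
    refine mem_closure_of_tendsto ht ?_
    have : ∀ᶠ t : ℝ in 𝓝[>] 0, ∀ i j, s.sgn (w i - w j + t • ((v i - v j) - (w i - w j))) =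
        s.sgn (v i - v j) :=
      eventually_all.2 fun i => eventually_all.2 fun j => s.approach _ _ (h i j)
    filter_upwards [this] with t ht
    funext i j
    change s.sgn _ = s.sgn _
    rw [← ht i j]
    congr 1
    simp only [Pi.add_apply, Pi.smul_apply, Pi.sub_apply, smul_sub]
    ring

/-- Upstairs the closure is a finite union of closures of permuted faces, and membership in the
closure of a face depends on the code only. -/
theorem stratum_subset_closure {v v' : Fin n → ℂ}
    (h : (closure (s.stratum v) ∩ s.stratum v').Nonempty) :
    s.stratum v' ⊆ closure (s.stratum v) := by
  obtain ⟨_, hz, w, hw, rfl⟩ := h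
  have h1 : w ∈ closure (proj ℂ n ⁻¹' s.stratum v) := by
    rw [← (isOpenMap_proj ℂ n).preimage_closure_eq_closure_preimage (continuous_proj ℂ n)]
    exact hz
  unfold stratum at h1
  rw [preimage_image_proj, closure_iUnion_of_finite] at h1
  obtain ⟨σ, hσ⟩ := Set.mem_iUnion.1 h1
  have hσ' : w ∘ σ ∈ closure (s.face v) :=
    map_mem_closure (f := fun v : Fin n → ℂ => v ∘ σ) (by fun_prop) hσ fun _ h => h
  rintro _ ⟨u, hu, rfl⟩
  have hc : s.code (u ∘ σ) = s.code (w ∘ σ) := code_comp_congr (hu.trans hw.symm) σ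
  have h2 : u ∘ σ ∈ closure (s.face v) := by
    rw [mem_closure_face] at hσ' ⊢
    rwa [hc]
  rw [← proj_comp_perm u σ]
  exact map_mem_closure (continuous_proj ℂ n) h2 fun x hx => ⟨x, hx, rfl⟩

theorem isStratification_strata [Finite K] : IsStratification (s.strata n) where
  isPartition := isPartition_strata
  locallyFinite := by
    have : Finite (s.strata n) := finite_strata
    exact locallyFinite_of_finite _
  isLocallyClosed := by
    rintro _ ⟨v, rfl⟩
    exact isLocallyClosed_stratum v
  isLocallyEuclidean := by
    rintro _ ⟨v, rfl⟩
    exact isLocallyEuclidean_stratum v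
  frontier := by
    rintro _ ⟨v, rfl⟩ _ ⟨w, rfl⟩ h
    exact stratum_subset_closure h

theorem exists_eq_stratum {S : Set (Sym ℂ n)} (hS : S ∈ s.strata n) {v : Fin n → ℂ}
    (hv : proj ℂ n v ∈ S) : S = s.stratum v := by
  obtain ⟨w, rfl⟩ := hS
  exact (stratum_eq_of_mem hv).symm

/-! ### Refinement and connectedness of strata -/

theorem refines_strata {K' : Type*} {s' : DiffSign K'}
    (h : ∀ w w', s.sgn w = s.sgn w' → s'.sgn w = s'.sgn w') :
    Refines (s.strata n) (s'.strata n) := by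
  rintro _ ⟨v, rfl⟩
  refine ⟨s'.stratum v, ⟨v, rfl⟩, Set.image_mono fun w hw => ?_⟩
  funext i j
  exact h _ _ (congrFun (congrFun hw i) j)

theorem convex_face (hs : ∀ k, Convex ℝ (s.sgn ⁻¹' {k})) (v : Fin n → ℂ) :
    Convex ℝ (s.face v) := by
  intro x hx y hy a b ha hb hab
  funext i j
  have h := hs (s.code v i j) (congrFun (congrFun hx i) j) (congrFun (congrFun hy i) j) ha hb hab
  refine Eq.trans ?_ h
  change s.sgn _ = s.sgn _
  congr 1
  simp only [Pi.add_apply, Pi.smul_apply, smul_sub]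
  ring

theorem isConnected_stratum (hs : ∀ k, Convex ℝ (s.sgn ⁻¹' {k})) (v : Fin n → ℂ) :
    IsConnected (s.stratum v) :=
  ⟨⟨_, proj_mem_stratum_self v⟩, (convex_face hs v).isPreconnected.image _
    (continuous_proj ℂ n).continuousOn⟩

end DiffSign

end SymProd

namespace SymProd

open Topology Filter

/-! ### Signs of real numbers -/

theorem eventually_sign_eq {x : ℝ} (hx : x ≠ 0) :
    ∀ᶠ y in 𝓝 x, SignType.sign y = SignType.sign x := by
  rcases lt_or_gt_of_ne hx with h | h
  · filter_upwards [eventually_lt_nhds h] with y hy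
    rw [sign_neg h, sign_neg hy]
  · filter_upwards [eventually_gt_nhds h] with y hy
    rw [sign_pos h, sign_pos hy]

theorem isClosed_sign_degen (a : SignType) :
    IsClosed {x : ℝ | SignType.sign x = a ∨ SignType.sign x = 0} := by
  rcases a.trichotomy with rfl | rfl | rfl
  · have : {x : ℝ | SignType.sign x = -1 ∨ SignType.sign x = 0} = Set.Iic 0 := by
      ext x
      simp [le_iff_lt_or_eq, sign_eq_neg_one_iff]
    rw [this]
    exact isClosed_Iic
  · have : {x : ℝ | SignType.sign x = 0 ∨ SignType.sign x = 0} = {0} := by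
      ext x
      simp
    rw [this]
    exact isClosed_singleton
  · have : {x : ℝ | SignType.sign x = 1 ∨ SignType.sign x = 0} = Set.Ici 0 := by
      ext x
      simp [le_iff_lt_or_eq, sign_eq_one_iff, eq_comm (a := (0 : ℝ))]
    rw [this]
    exact isClosed_Ici

theorem sign_segment {x y t : ℝ}
    (h : SignType.sign y = SignType.sign x ∨ SignType.sign y = 0) (h0 : 0 < t) (h1 : t < 1) :
    SignType.sign (y + t * (x - y)) = SignType.sign x := by
  have key : y + t * (x - y) = (1 - t) * y + t * x := by ring
  rw [key]
  rcases lt_trichotomy x 0 with hx | rfl | hx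
  · have hy : y ≤ 0 := by
      rw [sign_neg hx, sign_eq_neg_one_iff, sign_eq_zero_iff] at h
      rcases h with h | h <;> linarith
    rw [sign_neg hx]
    exact sign_neg (by nlinarith)
  · have hy : y = 0 := by simpa using h
    simp [hy]
  · have hy : 0 ≤ y := by
      rw [sign_pos hx, sign_eq_one_iff, sign_eq_zero_iff] at h
      rcases h with h | h <;> linarith
    rw [sign_pos hx]
    exact sign_pos (by nlinarith)

theorem eventually_sign_segment {x y : ℝ}
    (h : SignType.sign y = SignType.sign x ∨ SignType.sign y = 0) :
    ∀ᶠ t : ℝ in 𝓝[>] 0, SignType.sign (y + t * (x - y)) = SignType.sign x := by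
  filter_upwards [Ioo_mem_nhdsGT (zero_lt_one' ℝ)] with t ht
  exact sign_segment h ht.1 ht.2

theorem convex_sign (a : SignType) : Convex ℝ {x : ℝ | SignType.sign x = a} := by
  rcases a.trichotomy with rfl | rfl | rfl
  · have : {x : ℝ | SignType.sign x = -1} = Set.Iio 0 := by
      ext x
      simp [sign_eq_neg_one_iff]
    rw [this]
    exact convex_Iio 0
  · have : {x : ℝ | SignType.sign x = 0} = {0} := by
      ext x
      simp
    rw [this]
    exact convex_singleton 0
  · have : {x : ℝ | SignType.sign x = 1} = Set.Ioi 0 := by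
      ext x
      simp [sign_eq_one_iff]
    rw [this]
    exact convex_Ioi 0

/-- A non-zero value keeps its sign nearby, and a zero value may persist or not; these cases settle
`near` for classes defined by linear forms. -/
theorem eventually_sign_form (f : ℂ →L[ℝ] ℝ) (w : ℂ) : ∀ᶠ w' in 𝓝 w,
    (f w = 0 ∧ f w' = 0) ∨ (f w = 0 ∧ f w' ≠ 0) ∨
      (f w ≠ 0 ∧ f w' ≠ 0 ∧ SignType.sign (f w') = SignType.sign (f w)) := by
  by_cases h : f w = 0
  · exact Eventually.of_forall fun w' => by simp [h, em]
  · filter_upwards [(f.continuous.tendsto w).eventually (eventually_sign_eq h)] with w' h'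
    refine Or.inr (Or.inr ⟨h, fun h0 => h ?_, h'⟩)
    rwa [h0, sign_zero, eq_comm, sign_eq_zero_iff] at h'

theorem form_segment (f : ℂ →L[ℝ] ℝ) (u w : ℂ) (t : ℝ) :
    f (w + t • (u - w)) = f w + t * (f u - f w) := by
  rw [map_add, map_smul, map_sub, smul_eq_mul]

/-! ### The three kinds of signs -/

open Classical in
/-- The decomposition of `ℂ` into the origin and its complement. -/
noncomputable def zeroSign : DiffSign Prop where
  sgn w := w = 0
  span k := if k then ⊥ else ⊤
  rank k := if k then 0 else 1
  degen k l := k → l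
  eq_zero w h := by simpa using h
  mem_span w := by by_cases h : w = 0 <;> simp [h]
  near w := by
    by_cases h : w = 0
    · subst h
      refine Eventually.of_forall fun w' => ?_
      by_cases h' : w' = 0 <;> simp [h']
    · filter_upwards [isOpen_ne.mem_nhds h] with w' h'
      simp [h, show w' ≠ 0 from h']
  degen_refl _ := id
  isClosed_degen k := by
    by_cases h : k
    · convert isClosed_singleton (x := (0 : ℂ)) using 1
      ext
      simp [h]
    · simp [h]
  approach u w h := by
    by_cases hu : u = 0
    · simp [hu, h hu]
    by_cases hw : w = 0
    · filter_upwards [self_mem_nhdsWithin] with t ht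
      simp [hw, hu, (Set.mem_Ioi.1 ht).ne']
    · have hc : Tendsto (fun t : ℝ => w + t • (u - w)) (𝓝[>] 0) (𝓝 w) := by
        have : Tendsto (fun t : ℝ => w + t • (u - w)) (𝓝 0) (𝓝 (w + (0 : ℝ) • (u - w))) :=
          Continuous.tendsto (by fun_prop) 0
        rw [zero_smul, add_zero] at this
        exact this.mono_left nhdsWithin_le_nhds
      filter_upwards [hc.eventually_ne hw] with t ht
      simp only [ht, hu]

variable (f g : ℂ →L[ℝ] ℝ) (hfg : ∀ w, f w = 0 → g w = 0 → w = 0)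

/-- The decomposition of `ℂ` by the signs of two linear forms. -/
noncomputable def gridSign : DiffSign (SignType × SignType) where
  sgn w := (SignType.sign (f w), SignType.sign (g w))
  span k := (if k.1 = 0 then f.ker else ⊤) ⊓ (if k.2 = 0 then g.ker else ⊤)
  rank k := (if k.1 = 0 then 0 else 1) + (if k.2 = 0 then 0 else 1)
  degen k l := (l.1 = k.1 ∨ l.1 = 0) ∧ (l.2 = k.2 ∨ l.2 = 0)
  eq_zero w h := by
    simp only [map_zero, sign_zero, Prod.mk.injEq, sign_eq_zero_iff] at h
    exact hfg w h.1 h.2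
  mem_span w := by
    by_cases h1 : f w = 0 <;> by_cases h2 : g w = 0 <;> simp [h1, h2]
  near w := by
    filter_upwards [eventually_sign_form f w, eventually_sign_form g w] with w' h1 h2
    rcases h1 with ⟨h1, h1'⟩ | ⟨h1, h1'⟩ | ⟨h1, h1', h1s⟩ <;>
      rcases h2 with ⟨h2, h2'⟩ | ⟨h2, h2'⟩ | ⟨h2, h2', h2s⟩ <;> simp [*]
  degen_refl _ := ⟨Or.inl rfl, Or.inl rfl⟩
  isClosed_degen k := ((isClosed_sign_degen k.1).preimage f.continuous).inter
    ((isClosed_sign_degen k.2).preimage g.continuous)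
  approach u w h := by
    filter_upwards [eventually_sign_segment h.1, eventually_sign_segment h.2] with t h1 h2
    rw [form_segment, form_segment, h1, h2]

/-- The decomposition of `ℂ` by the sign of a linear form `f` and, where `f` vanishes, by the sign
of `g`. -/
noncomputable def lexSign : DiffSign (SignType × SignType) where
  -- The default value 0 makes `g` invisible off the kernel of `f`; pairs with both components
  -- non-zero do not occur.
  sgn w := (SignType.sign (f w), if f w = 0 then SignType.sign (g w) else 0)
  span k := if k.1 = 0 then (if k.2 = 0 then ⊥ else f.ker) else ⊤
  rank k := if k.1 = 0 then (if k.2 = 0 then 0 else 1) else 2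
  degen k l := (l.1 = k.1 ∨ l.1 = 0) ∧ (k.1 = 0 → l.2 = k.2 ∨ l.2 = 0)
  eq_zero w h := by
    simp only [map_zero, sign_zero, Prod.mk.injEq, sign_eq_zero_iff, if_true] at h
    exact hfg w h.1 (by simpa [h.1] using h.2)
  mem_span w := by
    by_cases h1 : f w = 0 <;> by_cases h2 : g w = 0 <;> simp [h1, h2]
    exact hfg w h1 h2
  near w := by
    filter_upwards [eventually_sign_form f w, eventually_sign_form g w] with w' h1 h2
    rcases h1 with ⟨h1, h1'⟩ | ⟨h1, h1'⟩ | ⟨h1, h1', h1s⟩ <;>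
      rcases h2 with ⟨h2, h2'⟩ | ⟨h2, h2'⟩ | ⟨h2, h2', h2s⟩ <;> simp [*] <;>
      rintro rfl <;> simp_all
  degen_refl _ := ⟨Or.inl rfl, fun _ => Or.inl rfl⟩
  isClosed_degen k := by
    by_cases hk : k.1 = 0
    · convert ((isClosed_singleton (x := (0 : ℝ))).preimage f.continuous).inter
        ((isClosed_sign_degen k.2).preimage g.continuous) using 1
      ext w
      by_cases hw : f w = 0 <;> simp [hk, hw]
    · convert (isClosed_sign_degen k.1).preimage f.continuous using 1
      ext w
      simp [hk]
  approach u w h := by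
    by_cases hu : f u = 0
    · have hw : f w = 0 := by simpa [hu] using h.1
      have h2 := h.2 (by simp [hu])
      simp only [hu, hw, if_true] at h2
      filter_upwards [eventually_sign_segment h2] with t ht
      rw [form_segment, form_segment, hu, hw, ht]
      simp
    · filter_upwards [eventually_sign_segment h.1] with t ht
      have h0 : f w + t * (f u - f w) ≠ 0 := by
        rwa [← sign_ne_zero, ht, sign_ne_zero]
      rw [form_segment, form_segment, ht, if_neg hu, if_neg h0]

/-! ### Convexity of the sign classes -/

theorem convex_gridSign (k : SignType × SignType) :
    Convex ℝ ((gridSign f g hfg).sgn ⁻¹' {k}) := by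
  have : (gridSign f g hfg).sgn ⁻¹' {k} = f ⁻¹' {x | SignType.sign x = k.1} ∩
      g ⁻¹' {x | SignType.sign x = k.2} := by
    ext w
    simp [gridSign, Prod.ext_iff]
  rw [this]
  exact ((convex_sign k.1).linear_preimage f.toLinearMap).inter
    ((convex_sign k.2).linear_preimage g.toLinearMap)

theorem convex_lexSign (k : SignType × SignType) :
    Convex ℝ ((lexSign f g hfg).sgn ⁻¹' {k}) := by
  by_cases hk : k.1 = 0
  · have : (lexSign f g hfg).sgn ⁻¹' {k} = f ⁻¹' {x | SignType.sign x = 0} ∩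
        g ⁻¹' {x | SignType.sign x = k.2} := by
      ext w
      by_cases hw : f w = 0 <;> simp [lexSign, Prod.ext_iff, hk, hw]
    rw [this]
    exact ((convex_sign 0).linear_preimage f.toLinearMap).inter
      ((convex_sign k.2).linear_preimage g.toLinearMap)
  · by_cases hk2 : k.2 = 0
    · have : (lexSign f g hfg).sgn ⁻¹' {k} = f ⁻¹' {x | SignType.sign x = k.1} := by
        ext w
        by_cases hw : f w = 0 <;> simp [lexSign, Prod.ext_iff, hk2, hw, Ne.symm hk]
      rw [this]
      exact (convex_sign k.1).linear_preimage f.toLinearMap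
    · have : (lexSign f g hfg).sgn ⁻¹' {k} = ∅ := by
        ext w
        by_cases hw : f w = 0 <;> simp [lexSign, Prod.ext_iff, hw, Ne.symm hk, Ne.symm hk2]
      rw [this]
      exact convex_empty

/-! ### Codes as coincidence and order patterns -/

theorem zeroSign_code_eq_iff {n : ℕ} {v w : Fin n → ℂ} :
    zeroSign.code v = zeroSign.code w ↔ ∀ i j, v i = v j ↔ w i = w j := by
  simp only [funext_iff, DiffSign.code, zeroSign, sub_eq_zero, eq_iff_iff]

theorem sign_sub_eq_iff {a b c d : ℝ} : SignType.sign (a - b) = SignType.sign (c - d) ↔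
    (a < b ↔ c < d) ∧ (b < a ↔ d < c) := by
  rcases lt_trichotomy a b with h | h | h <;> rcases lt_trichotomy c d with h' | h' | h' <;>
    simp [h, h', h.not_gt, h'.not_gt, sign_neg, sign_pos, sub_neg, sub_pos]

theorem forall_sign_sub_eq_iff {ι : Type*} {a b : ι → ℝ} :
    (∀ i j, SignType.sign (a i - a j) = SignType.sign (b i - b j)) ↔
      ∀ i j, a i < a j ↔ b i < b j := by
  simp only [sign_sub_eq_iff]
  exact ⟨fun h i j => (h i j).1, fun h i j => ⟨h i j, h j i⟩⟩

theorem gridSign_code_eq_iff {n : ℕ} {v w : Fin n → ℂ} :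
    (gridSign f g hfg).code v = (gridSign f g hfg).code w ↔
      (∀ i j, f (v i) < f (v j) ↔ f (w i) < f (w j)) ∧
      (∀ i j, g (v i) < g (v j) ↔ g (w i) < g (w j)) := by
  rw [← forall_sign_sub_eq_iff, ← forall_sign_sub_eq_iff]
  simp only [funext_iff, DiffSign.code, gridSign, map_sub, Prod.mk.injEq, forall_and]

theorem lexSign_code_eq_iff {n : ℕ} {v w : Fin n → ℂ} :
    (lexSign f g hfg).code v = (lexSign f g hfg).code w ↔
      (∀ i j, f (v i) < f (v j) ↔ f (w i) < f (w j)) ∧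
      (∀ i j, f (v i) = f (v j) → (g (v i) < g (v j) ↔ g (w i) < g (w j))) := by
  rw [← forall_sign_sub_eq_iff]
  simp only [funext_iff, DiffSign.code, lexSign, map_sub, Prod.mk.injEq, forall_and]
  refine and_congr_right fun h => ?_
  have h0 : ∀ i j, f (w i) - f (w j) = 0 ↔ f (v i) - f (v j) = 0 := fun i j => by
    rw [← sign_eq_zero_iff, ← h, sign_eq_zero_iff]
  constructor
  · intro h' i j hij
    have := h' i j
    rw [if_pos (sub_eq_zero.2 hij), if_pos ((h0 i j).2 (sub_eq_zero.2 hij)),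
      sign_sub_eq_iff] at this
    exact this.1
  · intro h' i j
    by_cases hij : f (v i) - f (v j) = 0
    · rw [if_pos hij, if_pos ((h0 i j).2 hij), sign_sub_eq_iff]
      exact ⟨h' i j (sub_eq_zero.1 hij), h' j i (sub_eq_zero.1 hij).symm⟩
    · rw [if_neg hij, if_neg (mt (h0 i j).1 hij)]

end SymProd

namespace SymProd

open Topology Filter

/-! ### Contingency cells as strata -/

/-- The signs of the real and the imaginary part. -/
noncomputable def contSign : DiffSign (SignType × SignType) :=
  gridSign Complex.reCLM Complex.imCLM fun _ h1 h2 => Complex.ext h1 h2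

theorem contSign_code_eq_iff {n : ℕ} {v w : Fin n → ℂ} :
    contSign.code v = contSign.code w ↔
      (∀ i j, (v i).re < (v j).re ↔ (w i).re < (w j).re) ∧
      (∀ i j, (v i).im < (v j).im ↔ (w i).im < (w j).im) :=
  gridSign_code_eq_iff _ _ _

/-- The contingency matrix that counts the fibres of a pair of surjections. -/
def CM.ofMaps {n p q : ℕ} (α : Fin n → Fin p) (β : Fin n → Fin q)
    (hα : Function.Surjective α) (hβ : Function.Surjective β) : CM n p q where
  m i j := (Finset.univ.filter fun k => α k = i ∧ β k = j).card
  col_ne i := by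
    obtain ⟨k, hk⟩ := hα i
    exact ⟨β k, (Finset.card_pos.2 ⟨k, by simp [hk]⟩).ne'⟩
  row_ne j := by
    obtain ⟨k, hk⟩ := hβ j
    exact ⟨α k, (Finset.card_pos.2 ⟨k, by simp [hk]⟩).ne'⟩
  weight := by
    have h1 : ∀ i, ∑ j, (Finset.univ.filter fun k => α k = i ∧ β k = j).card =
        (Finset.univ.filter fun k => α k = i).card := fun i => by
      rw [Finset.card_eq_sum_card_fiberwise (f := β) (t := Finset.univ) (by simp)]
      simp only [Finset.filter_filter]
    simp only [h1]
    rw [← Finset.card_eq_sum_card_fiberwise (by simp)]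
    simp

theorem contMap_eq {n p q : ℕ} {z : Sym ℂ n} {x : Fin p → ℝ} {y : Fin q → ℝ}
    (hx : StrictMono x) (hy : StrictMono y) (hxz : reValues z = Finset.univ.image x)
    (hyz : imValues z = Finset.univ.image y) (M : CM n p q)
    (hM : ∀ i j, M.m i j = (z : Multiset ℂ).countP fun w => w.re = x i ∧ w.im = y j) :
    contMap z = ⟨p, q, M⟩ := by
  have hp : (reValues z).card = p := by
    rw [hxz, Finset.card_image_of_injective _ hx.injective, Finset.card_fin]
  have hq : (imValues z).card = q := by
    rw [hyz, Finset.card_image_of_injective _ hy.injective, Finset.card_fin]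
  subst hp hq
  have h1 : x = xs z := Finset.orderEmbOfFin_unique rfl (fun i => by
    rw [hxz]; exact Finset.mem_image_of_mem _ (Finset.mem_univ i)) hx
  have h2 : y = ys z := Finset.orderEmbOfFin_unique rfl (fun i => by
    rw [hyz]; exact Finset.mem_image_of_mem _ (Finset.mem_univ i)) hy
  have : M = contMatrix z := by
    ext i j
    rw [hM, h1, h2]
    rfl
  rw [this]
  rfl

theorem image_comp_univ {ι κ X : Type*} [Fintype ι] [Fintype κ] [DecidableEq X] {α : ι → κ}
    (hα : Function.Surjective α) (x : κ → X) :
    Finset.univ.image (x ∘ α) = Finset.univ.image x := by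
  ext a
  simp only [Finset.mem_image, Finset.mem_univ, true_and, Function.comp_apply]
  exact (hα.exists (p := fun b => x b = a)).symm

theorem reValues_proj {n : ℕ} (v : Fin n → ℂ) :
    reValues (proj ℂ n v) = Finset.univ.image fun k => (v k).re := by
  ext a
  simp [reValues, coe_proj]

theorem imValues_proj {n : ℕ} (v : Fin n → ℂ) :
    imValues (proj ℂ n v) = Finset.univ.image fun k => (v k).im := by
  ext a
  simp [imValues, coe_proj]

theorem contMap_proj {n p q : ℕ} {x : Fin p → ℝ} {y : Fin q → ℝ} (hx : StrictMono x)
    (hy : StrictMono y) {α : Fin n → Fin p} {β : Fin n → Fin q} (hα : Function.Surjective α)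
    (hβ : Function.Surjective β) :
    contMap (proj ℂ n fun k => ⟨x (α k), y (β k)⟩) = ⟨p, q, CM.ofMaps α β hα hβ⟩ := by
  refine contMap_eq hx hy ?_ ?_ _ fun i j => ?_
  · rw [reValues_proj]
    exact image_comp_univ hα x
  · rw [imValues_proj]
    exact image_comp_univ hβ y
  · rw [coe_proj, Multiset.countP_map]
    simp only [hx.injective.eq_iff, hy.injective.eq_iff]
    rfl

theorem exists_rank {n : ℕ} (a : Fin n → ℝ) : ∃ (p : ℕ) (x : Fin p → ℝ) (α : Fin n → Fin p),
    StrictMono x ∧ Function.Surjective α ∧ ∀ k, a k = x (α k) := by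
  let S := Finset.univ.image a
  have hr : ∀ k, ∃ i, S.orderEmbOfFin rfl i = a k := fun k => by
    have : a k ∈ Set.range (S.orderEmbOfFin rfl) := by
      rw [Finset.range_orderEmbOfFin]
      exact Finset.mem_image_of_mem a (Finset.mem_univ k)
    exact this
  choose α hα using hr
  refine ⟨S.card, S.orderEmbOfFin rfl, α, (S.orderEmbOfFin rfl).strictMono, fun i => ?_,
    fun k => (hα k).symm⟩
  have := Finset.orderEmbOfFin_mem S rfl i
  obtain ⟨k, -, hk⟩ := Finset.mem_image.1 this
  exact ⟨k, (S.orderEmbOfFin rfl).injective ((hα k).trans hk)⟩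

theorem exists_ranks {n : ℕ} (v : Fin n → ℂ) : ∃ (p q : ℕ) (x : Fin p → ℝ) (y : Fin q → ℝ)
    (α : Fin n → Fin p) (β : Fin n → Fin q), StrictMono x ∧ StrictMono y ∧
    Function.Surjective α ∧ Function.Surjective β ∧ v = fun k => ⟨x (α k), y (β k)⟩ := by
  obtain ⟨p, x, α, hx, hα, h1⟩ := exists_rank fun k => (v k).re
  obtain ⟨q, y, β, hy, hβ, h2⟩ := exists_rank fun k => (v k).im
  exact ⟨p, q, x, y, α, β, hx, hy, hα, hβ, funext fun k => Complex.ext (h1 k) (h2 k)⟩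

/-- Read the entries as multiplicities of the positions `(i, j)` and enumerate the resulting `n`
positions; surjectivity is the absence of zero rows and columns. -/
theorem exists_ofMaps {n p q : ℕ} (M : CM n p q) : ∃ (α : Fin n → Fin p) (β : Fin n → Fin q)
    (hα : Function.Surjective α) (hβ : Function.Surjective β), M = CM.ofMaps α β hα hβ := by
  have hcard : Multiset.card (∑ i, ∑ j, Multiset.replicate (M.m i j) (i, j)) = n := by
    simp [M.weight]
  obtain ⟨d, hd⟩ := exists_map_univ_eq hcard
  have hc : ∀ i j, (Finset.univ.filter fun k => (d k).1 = i ∧ (d k).2 = j).card = M.m i j := by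
    intro i j
    have := congrArg (Multiset.count (i, j)) hd
    rw [Multiset.count_map] at this
    simp only [Multiset.count_sum', Multiset.count_replicate, Prod.mk.injEq] at this
    rw [Finset.sum_eq_single i (by
      intro b _ hb; simp [hb]) (by simp),
      Finset.sum_eq_single j (by intro b _ hb; simp [hb]) (by simp)] at this
    rw [if_pos ⟨rfl, rfl⟩] at this
    rw [← this, ← Finset.filter_val, Finset.card_def]
    congr 2
    ext k
    simp [Prod.ext_iff, eq_comm]
  refine ⟨fun k => (d k).1, fun k => (d k).2, fun i => ?_, fun j => ?_, ?_⟩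
  · obtain ⟨j, hj⟩ := M.col_ne i
    rw [← hc] at hj
    obtain ⟨k, hk⟩ := Finset.card_pos.1 (Nat.pos_of_ne_zero hj)
    exact ⟨k, (Finset.mem_filter.1 hk).2.1⟩
  · obtain ⟨i, hi⟩ := M.row_ne j
    rw [← hc] at hi
    obtain ⟨k, hk⟩ := Finset.card_pos.1 (Nat.pos_of_ne_zero hi)
    exact ⟨k, (Finset.mem_filter.1 hk).2.2⟩
  · ext i j
    exact (hc i j).symm

theorem exists_perm_of_ofMaps_eq {n p q : ℕ} {α α' : Fin n → Fin p} {β β' : Fin n → Fin q}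
    {hα : Function.Surjective α} {hβ : Function.Surjective β} {hα' : Function.Surjective α'}
    {hβ' : Function.Surjective β'} (h : CM.ofMaps α β hα hβ = CM.ofMaps α' β' hα' hβ') :
    ∃ σ : Equiv.Perm (Fin n), α' = α ∘ σ ∧ β' = β ∘ σ := by
  have hm : Multiset.map (fun k => (α k, β k)) Finset.univ.val =
      Multiset.map (fun k => (α' k, β' k)) Finset.univ.val := by
    ext ⟨i, j⟩
    have := congrFun (congrFun (congrArg CM.m h) i) j
    rw [Multiset.count_map, Multiset.count_map]
    simp only [Prod.mk.injEq, eq_comm (a := i), eq_comm (a := j)]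
    exact this
  obtain ⟨σ, hσ⟩ := exists_equiv_of_map_eq hm
  exact ⟨σ, funext fun k => congrArg Prod.fst (congrFun hσ k),
    funext fun k => congrArg Prod.snd (congrFun hσ k)⟩

theorem contSign_code_of_ranks {n p q : ℕ} {x x' : Fin p → ℝ} {y y' : Fin q → ℝ}
    (hx : StrictMono x) (hy : StrictMono y) (hx' : StrictMono x') (hy' : StrictMono y')
    (α : Fin n → Fin p) (β : Fin n → Fin q) :
    contSign.code (fun k => (⟨x (α k), y (β k)⟩ : ℂ)) =
      contSign.code fun k => (⟨x' (α k), y' (β k)⟩ : ℂ) := by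
  rw [contSign_code_eq_iff]
  exact ⟨fun i j => by simp [hx.lt_iff_lt, hx'.lt_iff_lt],
    fun i j => by simp [hy.lt_iff_lt, hy'.lt_iff_lt]⟩

/-- The same strict order implies the same ties, so `b` is determined by the index of the value of
`a`. -/
theorem exists_strictMono_factor {n p : ℕ} {a b : Fin n → ℝ} (h : ∀ i j, a i < a j ↔ b i < b j)
    {x : Fin p → ℝ} (hx : StrictMono x) {α : Fin n → Fin p} (hα : Function.Surjective α)
    (ha : ∀ k, a k = x (α k)) : ∃ x' : Fin p → ℝ, StrictMono x' ∧ ∀ k, b k = x' (α k) := by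
  obtain ⟨r, hr⟩ := hα.hasRightInverse
  refine ⟨fun i => b (r i), fun i j hij => ?_, fun k => ?_⟩
  · rw [← h, ha, ha, hr, hr]
    exact hx hij
  · have h1 : a k = a (r (α k)) := by rw [ha, ha, hr]
    exact le_antisymm (not_lt.1 fun h2 => by rw [← h] at h2; exact h2.ne h1.symm)
      (not_lt.1 fun h2 => by rw [← h] at h2; exact h2.ne h1)

/-- In sorted coordinates the matrix counts the fibres of the index maps, so it determines them up
to a permutation, and the code sees only these maps. -/
theorem contCell_eq_stratum {n p q : ℕ} {x : Fin p → ℝ} {y : Fin q → ℝ} (hx : StrictMono x)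
    (hy : StrictMono y) {α : Fin n → Fin p} {β : Fin n → Fin q} (hα : Function.Surjective α)
    (hβ : Function.Surjective β) :
    contCell ⟨p, q, CM.ofMaps α β hα hβ⟩ = contSign.stratum fun k => ⟨x (α k), y (β k)⟩ := by
  ext z
  constructor
  · intro hz
    obtain ⟨v, rfl⟩ := proj_surjective ℂ n z
    obtain ⟨p', q', x', y', α', β', hx', hy', hα', hβ', rfl⟩ := exists_ranks v
    have hz' : contMap _ = _ := hz
    rw [contMap_proj hx' hy' hα' hβ'] at hz'
    simp only [Sigma.mk.injEq] at hz'
    obtain ⟨rfl, hz'⟩ := hz'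
    rw [heq_eq_eq, Sigma.mk.injEq] at hz'
    obtain ⟨rfl, hz'⟩ := hz'
    obtain ⟨σ, rfl, rfl⟩ := exists_perm_of_ofMaps_eq (eq_of_heq hz')
    exact DiffSign.proj_mem_stratum.2 ⟨σ, contSign_code_of_ranks hx' hy' hx hy _ _⟩
  · rintro ⟨v, hv, rfl⟩
    obtain ⟨h1, h2⟩ := contSign_code_eq_iff.1 hv.symm
    obtain ⟨x', hx', hx1⟩ := exists_strictMono_factor h1 hx hα fun _ => rfl
    obtain ⟨y', hy', hy1⟩ := exists_strictMono_factor h2 hy hβ fun _ => rfl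
    have : v = fun k => (⟨x' (α k), y' (β k)⟩ : ℂ) :=
      funext fun k => Complex.ext (hx1 k) (hy1 k)
    rw [this]
    exact contMap_proj hx' hy' hα hβ

theorem strictMono_val (p : ℕ) : StrictMono fun i : Fin p => ((i : ℕ) : ℝ) :=
  fun _ _ h => Nat.cast_lt.2 h

theorem exists_contCell_eq_stratum {n : ℕ} (M : CMn n) :
    ∃ v : Fin n → ℂ, contCell M = contSign.stratum v := by
  obtain ⟨p, q, M⟩ := M
  obtain ⟨α, β, hα, hβ, rfl⟩ := exists_ofMaps M
  exact ⟨_, contCell_eq_stratum (strictMono_val p) (strictMono_val q) hα hβ⟩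

theorem contCell_contMap_proj {n : ℕ} (v : Fin n → ℂ) :
    contCell (contMap (proj ℂ n v)) = contSign.stratum v := by
  obtain ⟨w, hw⟩ := exists_contCell_eq_stratum (contMap (proj ℂ n v))
  have : proj ℂ n v ∈ contCell (contMap (proj ℂ n v)) := rfl
  rw [hw] at this ⊢
  exact (DiffSign.stratum_eq_of_mem this).symm

theorem contStrata_eq (n : ℕ) : contStrata n = contSign.strata n := by
  ext S
  constructor
  · rintro ⟨M, rfl⟩
    obtain ⟨v, hv⟩ := exists_contCell_eq_stratum M
    exact ⟨v, hv.symm⟩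
  · rintro ⟨v, rfl⟩
    exact ⟨_, (contCell_contMap_proj v).symm⟩

/-! ### Complex strata -/

/-- Each distinct value is represented by its first index. The resulting formula involves `v` only
through coincidences of its entries. -/
theorem parts_ofSym_proj {n : ℕ} (v : Fin n → ℂ) :
    (Nat.Partition.ofSym (proj ℂ n v)).parts =
      (Finset.univ.filter fun i => ∀ j, j < i → v j ≠ v i).val.map
        fun i => (Finset.univ.filter fun k => v k = v i).card := by
  have h1 : (Multiset.map v Finset.univ.val).toFinset =
      (Finset.univ.filter fun i => ∀ j, j < i → v j ≠ v i).image v := by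
    ext a
    simp only [Multiset.mem_toFinset, Multiset.mem_map, Finset.mem_image, Finset.mem_filter,
      Finset.mem_univ, true_and]
    constructor
    · rintro ⟨i, -, rfl⟩
      let T := Finset.univ.filter fun k => v k = v i
      have hT : T.Nonempty := ⟨i, by simp [T]⟩
      have hm : v (T.min' hT) = v i := (Finset.mem_filter.1 (T.min'_mem hT)).2
      refine ⟨T.min' hT, fun j hj h => ?_, hm⟩
      exact absurd (T.min'_le j (by simp [T, h, hm])) (not_le.2 hj)
    · rintro ⟨i, -, rfl⟩
      exact ⟨i, Finset.mem_univ i, rfl⟩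
  have hinj : Set.InjOn v (Finset.univ.filter fun i => ∀ j, j < i → v j ≠ v i : Finset (Fin n)) := by
    intro i hi j hj hij
    simp only [Finset.coe_filter, Finset.mem_univ, true_and] at hi hj
    rcases lt_trichotomy i j with h | h | h
    · exact absurd hij (hj i h)
    · exact h
    · exact absurd hij.symm (hi j h)
  change Multiset.map (fun a => Multiset.count a (Multiset.map v Finset.univ.val))
    (Multiset.map v Finset.univ.val).toFinset.val = _
  rw [h1, Finset.image_val_of_injOn hinj, Multiset.map_map]
  refine Multiset.map_congr rfl fun i _ => ?_
  rw [Function.comp_apply, Multiset.count_map]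
  simp only [eq_comm (a := v i)]
  rfl

theorem ofSym_proj_congr {n : ℕ} {v w : Fin n → ℂ} (h : ∀ i j, v i = v j ↔ w i = w j) :
    Nat.Partition.ofSym (proj ℂ n v) = Nat.Partition.ofSym (proj ℂ n w) := by
  ext1
  rw [parts_ofSym_proj, parts_ofSym_proj]
  simp only [ne_eq, h]

/-- Equal partitions give a multiplicity-preserving bijection `e` of the sets of distinct values.
Relabelling `w` by `e` yields the multiset of `v`, hence a permutation. -/
theorem exists_perm_of_ofSym_eq {n : ℕ} {v w : Fin n → ℂ}
    (h : Nat.Partition.ofSym (proj ℂ n v) = Nat.Partition.ofSym (proj ℂ n w)) :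
    ∃ σ : Equiv.Perm (Fin n), ∀ i j, w (σ i) = w (σ j) ↔ v i = v j := by
  let S : (Fin n → ℂ) → Multiset ℂ := fun v => Multiset.map v Finset.univ.val
  have hS : ∀ v : Fin n → ℂ, (Nat.Partition.ofSym (proj ℂ n v)).parts =
      Multiset.map (fun a : (S v).toFinset => (S v).count a.1) Finset.univ.val := fun v => by
    change Multiset.map (fun a => (S v).count a) (S v).toFinset.val = _
    conv_lhs => rw [← Finset.attach_map_val (s := (S v).toFinset)]
    rw [Finset.map_val, Multiset.map_map]
    rfl
  have h' := congrArg Nat.Partition.parts h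
  rw [hS, hS] at h'
  obtain ⟨e, he⟩ := exists_equiv_of_map_eq h'
  have hmem : ∀ (v : Fin n → ℂ) i, v i ∈ (S v).toFinset := fun v i =>
    Multiset.mem_toFinset.2 (Multiset.mem_map_of_mem v (Finset.mem_univ i))
  have hm : Multiset.map (fun i => e ⟨w i, hmem w i⟩) Finset.univ.val =
      Multiset.map (fun i => (⟨v i, hmem v i⟩ : (S v).toFinset)) Finset.univ.val := by
    have hcount : ∀ (v : Fin n → ℂ) (a : (S v).toFinset), (S v).count a.1 =
        Multiset.count a (Multiset.map (fun i => (⟨v i, hmem v i⟩ : (S v).toFinset))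
          Finset.univ.val) := fun v a => by
      rw [← Multiset.count_map_eq_count' Subtype.val _ Subtype.val_injective, Multiset.map_map]
      rfl
    ext a
    rw [← hcount v a]
    obtain ⟨b, rfl⟩ := e.surjective a
    rw [show (S v).count (e b).1 = (S w).count b.1 from (congrFun he b).symm, hcount w b,
      ← Multiset.count_map_eq_count' e _ e.injective, Multiset.map_map]
    rfl
  obtain ⟨σ, hσ⟩ := exists_equiv_of_map_eq hm
  refine ⟨σ, fun i j => ?_⟩
  have h1 : ∀ i, v i = (e ⟨w (σ i), hmem w (σ i)⟩).1 := fun i =>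
    congrArg Subtype.val (congrFun hσ i)
  rw [h1 i, h1 j, Subtype.val_inj, e.injective.eq_iff, Subtype.mk.injEq]

theorem complexStratum_ofSym {n : ℕ} (v : Fin n → ℂ) :
    complexStratum (Nat.Partition.ofSym (proj ℂ n v)) = zeroSign.stratum v := by
  ext z
  obtain ⟨w, rfl⟩ := proj_surjective ℂ n z
  rw [DiffSign.proj_mem_stratum]
  simp only [zeroSign_code_eq_iff]
  constructor
  · intro h
    exact exists_perm_of_ofSym_eq (Eq.symm h)
  · rintro ⟨σ, hσ⟩
    change Nat.Partition.ofSym _ = _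
    rw [← proj_comp_perm w σ]
    exact ofSym_proj_congr hσ

/-- Natural numbers serve as points with the prescribed multiplicities; thus no complex stratum is
empty. -/
theorem exists_ofSym_eq {n : ℕ} (l : n.Partition) :
    ∃ z : Sym ℂ n, Nat.Partition.ofSym z = l := by
  obtain ⟨c, hc⟩ := exists_map_univ_eq (rfl : Multiset.card l.parts = _)
  let s : Multiset ℂ := ∑ k, Multiset.replicate (c k) ((k : ℕ) : ℂ)
  have hinj : Function.Injective fun k : Fin (Multiset.card l.parts) => ((k : ℕ) : ℂ) :=
    fun a b h => Fin.ext (Nat.cast_injective h)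
  have hpos : ∀ k, 0 < c k := fun k =>
    l.parts_pos (by rw [← hc]; exact Multiset.mem_map_of_mem c (Finset.mem_univ k))
  have hs : Multiset.card s = n := by
    have h2 : ∑ k, c k = n := by
      change (Multiset.map c Finset.univ.val).sum = n
      rw [hc]
      exact l.parts_sum
    simpa [s] using h2
  have hcount : ∀ k : Fin (Multiset.card l.parts), s.count ((k : ℕ) : ℂ) = c k := fun k => by
    simp only [s, Multiset.count_sum', Multiset.count_replicate]
    rw [Finset.sum_eq_single k (fun b _ hb => if_neg (hinj.ne hb)) (by simp), if_pos rfl]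
  have hfin : s.toFinset = Finset.univ.image
      fun k : Fin (Multiset.card l.parts) => ((k : ℕ) : ℂ) := by
    ext a
    simp only [Multiset.mem_toFinset, s, Multiset.mem_sum, Multiset.mem_replicate,
      Finset.mem_image, Finset.mem_univ, true_and]
    exact ⟨fun ⟨k, _, h⟩ => ⟨k, h.symm⟩, fun ⟨k, h⟩ => ⟨k, (hpos k).ne', h.symm⟩⟩
  refine ⟨⟨s, hs⟩, ?_⟩
  ext1
  change Multiset.map (fun a => s.count a) s.toFinset.val = _
  rw [hfin, Finset.image_val_of_injOn hinj.injOn, Multiset.map_map]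
  exact (Multiset.map_congr rfl fun k _ => hcount k).trans hc

theorem complexStrata_eq (n : ℕ) : complexStrata n = zeroSign.strata n := by
  ext S
  constructor
  · rintro ⟨l, rfl⟩
    obtain ⟨z, rfl⟩ := exists_ofSym_eq l
    obtain ⟨v, rfl⟩ := proj_surjective ℂ n z
    exact ⟨v, (complexStratum_ofSym v).symm⟩
  · rintro ⟨v, rfl⟩
    exact ⟨_, (complexStratum_ofSym v).symm⟩

end SymProd

namespace SymProd

open Topology Filter

/-! ### Fox–Neuwirth–Fuchs cells as strata -/

/-- The sign of the imaginary part and, on the real line, of the real part. -/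
noncomputable def fnfSign : DiffSign (SignType × SignType) :=
  lexSign Complex.imCLM Complex.reCLM fun _ h1 h2 => Complex.ext h2 h1

theorem fnfSign_code_eq_iff {n : ℕ} {v w : Fin n → ℂ} :
    fnfSign.code v = fnfSign.code w ↔
      (∀ i j, (v i).im < (v j).im ↔ (w i).im < (w j).im) ∧
      (∀ i j, (v i).im = (v j).im → ((v i).re < (v j).re ↔ (w i).re < (w j).re)) :=
  lexSign_code_eq_iff _ _ _

theorem sum_filter_eq {A B : Type*} [DecidableEq B] {k : ℕ} (s : Multiset A) (f : A → B)
    {e : Fin k → B} (he : Function.Injective e) (hs : ∀ a ∈ s, ∃ i, e i = f a) :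
    ∑ i, s.filter (fun a => f a = e i) = s := by
  induction s using Multiset.induction with
  | empty => simp
  | cons a s ih =>
    obtain ⟨i₀, hi₀⟩ := hs a (Multiset.mem_cons_self a s)
    have ih' := ih fun b hb => hs b (Multiset.mem_cons_of_mem hb)
    simp only [Multiset.filter_cons, Finset.sum_add_distrib, ih', ← hi₀, he.eq_iff]
    simp

theorem filter_sum {A ι : Type*} (P : A → Prop) [DecidablePred P] (t : Finset ι)
    (f : ι → Multiset A) : (∑ i ∈ t, f i).filter P = ∑ i ∈ t, (f i).filter P := by
  classical
  induction t using Finset.induction with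
  | empty => simp
  | insert a t ha ih => rw [Finset.sum_insert ha, Finset.sum_insert ha, Multiset.filter_add, ih]

theorem map_sum_multiset {A B ι : Type*} (g : A → B) (t : Finset ι) (f : ι → Multiset A) :
    (∑ i ∈ t, f i).map g = ∑ i ∈ t, (f i).map g :=
  map_sum (Multiset.mapAddMonoidHom g) _ _

theorem sum_replicate {A ι : Type*} (t : Finset ι) (c : ι → ℕ) (a : A) :
    ∑ i ∈ t, Multiset.replicate (c i) a = Multiset.replicate (∑ i ∈ t, c i) a :=
  (map_sum (Multiset.replicateAddMonoidHom a) _ _).symm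

/-- The index set of the points in the cell of `β`, `γ`. -/
abbrev CellIndex {n : ℕ} (β : Composition n)
    (γ : ∀ j : Fin β.length, Composition (β.blocksFun j)) : Type :=
  Σ j : Fin β.length, Fin (γ j).length

/-- The multiplicities of the points in the cell of `β`, `γ`. -/
def cellDivisor {n : ℕ} (β : Composition n)
    (γ : ∀ j : Fin β.length, Composition (β.blocksFun j)) : Multiset (CellIndex β γ) :=
  ∑ j, ∑ k, Multiset.replicate ((γ j).blocksFun k) ⟨j, k⟩

variable {n : ℕ} {β : Composition n} {γ : ∀ j : Fin β.length, Composition (β.blocksFun j)}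

theorem card_cellDivisor : Multiset.card (cellDivisor β γ) = n := by
  simp [cellDivisor, Composition.sum_blocksFun]

theorem map_cellDivisor {A : Type*} (f : CellIndex β γ → A) : (cellDivisor β γ).map f =
    ∑ j, ∑ k, Multiset.replicate ((γ j).blocksFun k) (f ⟨j, k⟩) := by
  simp only [cellDivisor, map_sum_multiset, Multiset.map_replicate]

theorem mem_cellDivisor (a : CellIndex β γ) : a ∈ cellDivisor β γ := by
  obtain ⟨j, k⟩ := a
  simp only [cellDivisor, Multiset.mem_sum, Finset.mem_univ, true_and]
  exact ⟨j, k, Multiset.mem_replicate.2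
    ⟨((γ j).blocks_pos' k k.2).ne', rfl⟩⟩

/-- The row-by-row conditions are merged into one: the configuration is a placement of a fixed
divisor of indices, ready to be enumerated by `Fin n`. -/
theorem mem_fnfCell_iff {z : Sym ℂ n} : z ∈ fnfCell β γ ↔
    ∃ (y : Fin β.length → ℝ) (x : ∀ j, Fin (γ j).length → ℝ), StrictMono y ∧
      (∀ j, StrictMono (x j)) ∧
      (z : Multiset ℂ) = (cellDivisor β γ).map fun a => ⟨x a.1 a.2, y a.1⟩ := by
  constructor
  · rintro ⟨y, hy, him, hre⟩
    choose x hx hxz using hre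
    refine ⟨y, x, hy, hx, ?_⟩
    have hs : ∀ a ∈ (z : Multiset ℂ), ∃ i, y i = a.im := fun a ha => by
      have : a.im ∈ (z : Multiset ℂ).map Complex.im := Multiset.mem_map_of_mem _ ha
      rw [him] at this
      simp only [Multiset.mem_sum, Finset.mem_univ, true_and] at this
      obtain ⟨j, hj⟩ := this
      exact ⟨j, (Multiset.eq_of_mem_replicate hj).symm⟩
    rw [map_cellDivisor, ← sum_filter_eq (z : Multiset ℂ) Complex.im hy.injective hs]
    refine Finset.sum_congr rfl fun j _ => ?_
    have h1 : (z : Multiset ℂ).filter (fun a => a.im = y j) =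
        (((z : Multiset ℂ).filter fun a => a.im = y j).map Complex.re).map
          fun t => (⟨t, y j⟩ : ℂ) := by
      rw [Multiset.map_map]
      conv_lhs => rw [← Multiset.map_id ((z : Multiset ℂ).filter fun a => a.im = y j)]
      refine Multiset.map_congr rfl fun a ha => ?_
      exact Complex.ext rfl (Multiset.mem_filter.1 ha).2
    rw [h1, hxz, map_sum_multiset]
    simp only [Multiset.map_replicate]
  · rintro ⟨y, x, hy, hx, hz⟩
    refine ⟨y, hy, ?_, fun j => ⟨x j, hx j, ?_⟩⟩
    · rw [hz, Multiset.map_map, map_cellDivisor]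
      refine Finset.sum_congr rfl fun j _ => ?_
      simp only [Function.comp_apply, sum_replicate, Composition.sum_blocksFun]
    · rw [hz, map_cellDivisor, filter_sum, map_sum_multiset,
        Finset.sum_eq_single j]
      · rw [filter_sum, map_sum_multiset]
        refine Finset.sum_congr rfl fun k _ => ?_
        rw [Multiset.filter_eq_self.2 fun a ha => by rw [Multiset.eq_of_mem_replicate ha],
          Multiset.map_replicate]
      · intro i _ hij
        rw [filter_sum, map_sum_multiset]
        refine Finset.sum_eq_zero fun k _ => ?_
        rw [Multiset.filter_eq_nil.2, Multiset.map_zero]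
        intro a ha h
        rw [Multiset.eq_of_mem_replicate ha] at h
        exact hij (hy.injective h)
      · simp

theorem exists_mem_realCell (s : Multiset ℝ) (hs : Multiset.card s = n) :
    ∃ β : Composition n, s ∈ realCell β := by
  let S := s.toFinset
  let e := S.orderEmbOfFin rfl
  have he : ∀ i, e i ∈ s := fun i => Multiset.mem_toFinset.1 (Finset.orderEmbOfFin_mem S rfl i)
  have hsum : ∑ i, Multiset.replicate (s.count (e i)) (e i) = s := by
    conv_rhs => rw [← sum_filter_eq s id e.injective fun a ha => by
      have : a ∈ Set.range e := by
        rw [Finset.range_orderEmbOfFin]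
        exact Multiset.mem_toFinset.2 ha
      exact this]
    refine Finset.sum_congr rfl fun i _ => ?_
    rw [← Multiset.filter_eq']
    rfl
  let β : Composition n := ⟨List.ofFn fun i => s.count (e i), fun {i} hi => by
    obtain ⟨k, rfl⟩ := (List.mem_ofFn' _ _).1 hi
    exact Multiset.count_pos.2 (he k), by
    rw [List.sum_ofFn, ← hs, ← congrArg Multiset.card hsum]
    simp⟩
  have hl : β.length = S.card := List.length_ofFn
  refine ⟨β, fun i => e (Fin.cast hl i), fun i j hij => e.strictMono hij, ?_⟩
  conv_lhs => rw [← hsum]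
  refine (Equiv.sum_comp (finCongr hl) _).symm.trans (Finset.sum_congr rfl fun i _ => ?_)
  congr 1
  simp only [β, Composition.blocksFun, List.get_ofFn]
  rfl

theorem exists_mem_fnfCell (z : Sym ℂ n) :
    ∃ (β : Composition n) (γ : ∀ j : Fin β.length, Composition (β.blocksFun j)),
      z ∈ fnfCell β γ := by
  obtain ⟨β, y, hy, hz⟩ := exists_mem_realCell (n := n) ((z : Multiset ℂ).map Complex.im)
    ((Multiset.card_map _ _).trans z.2)
  have hc : ∀ j, Multiset.card (((z : Multiset ℂ).filter fun w => w.im = y j).map Complex.re) =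
      β.blocksFun j := fun j => by
    rw [Multiset.card_map, ← Multiset.countP_eq_card_filter]
    have := congrArg (Multiset.count (y j)) hz
    rw [Multiset.count_map, Multiset.count_sum', ← Multiset.countP_eq_card_filter] at this
    simp only [Multiset.count_replicate, hy.injective.eq_iff, Finset.sum_ite_eq',
      Finset.mem_univ, if_true, eq_comm (a := y j)] at this
    exact this
  choose γ hγ using fun j => exists_mem_realCell _ (hc j)
  exact ⟨β, γ, y, hy, hz, hγ⟩

theorem fnfSign_code_of_index {d : Fin n → CellIndex β γ} {y y' : Fin β.length → ℝ}
    {x x' : ∀ j, Fin (γ j).length → ℝ} (hy : StrictMono y) (hx : ∀ j, StrictMono (x j))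
    (hy' : StrictMono y') (hx' : ∀ j, StrictMono (x' j)) :
    fnfSign.code (fun k => (⟨x (d k).1 (d k).2, y (d k).1⟩ : ℂ)) =
      fnfSign.code fun k => (⟨x' (d k).1 (d k).2, y' (d k).1⟩ : ℂ) := by
  rw [fnfSign_code_eq_iff]
  refine ⟨fun i j => by simp [hy.lt_iff_lt, hy'.lt_iff_lt], fun i j h => ?_⟩
  simp only at h ⊢
  have h1 := hy.injective h
  generalize d i = a at h1 ⊢
  generalize d j = b at h1 ⊢
  obtain ⟨a, a'⟩ := a
  obtain ⟨b, b'⟩ := b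
  simp only at h1
  subst h1
  rw [(hx a).lt_iff_lt, (hx' a).lt_iff_lt]

theorem exists_fnfCell_eq_stratum (β : Composition n)
    (γ : ∀ j : Fin β.length, Composition (β.blocksFun j)) :
    ∃ v : Fin n → ℂ, fnfCell β γ = fnfSign.stratum v := by
  obtain ⟨d, hd⟩ := exists_map_univ_eq (card_cellDivisor (β := β) (γ := γ))
  have hsurj : Function.Surjective d := fun a => by
    have := mem_cellDivisor a
    rw [← hd] at this
    obtain ⟨k, -, hk⟩ := Multiset.mem_map.1 this
    exact ⟨k, hk⟩
  have hproj : ∀ f : CellIndex β γ → ℂ, ((proj ℂ n (f ∘ d) : Sym ℂ n) : Multiset ℂ) =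
      (cellDivisor β γ).map f := fun f => by
    rw [coe_proj, ← hd, Multiset.map_map]
  -- A model configuration: row and position within the row serve as coordinates.
  let F : CellIndex β γ → ℂ := fun a => ⟨((a.2 : ℕ) : ℝ), ((a.1 : ℕ) : ℝ)⟩
  refine ⟨F ∘ d, ?_⟩
  ext z
  rw [mem_fnfCell_iff]
  constructor
  · rintro ⟨y, x, hy, hx, hz⟩
    refine ⟨(fun a => (⟨x a.1 a.2, y a.1⟩ : ℂ)) ∘ d, ?_, Subtype.ext ?_⟩
    · exact fnfSign_code_of_index (x' := fun j => _) hy hx (strictMono_val _)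
        fun j => strictMono_val _
    · exact (hproj _).trans hz.symm
  · rintro ⟨v, hv, rfl⟩
    obtain ⟨h1, h2⟩ := fnfSign_code_eq_iff.1 hv.symm
    obtain ⟨r, hr⟩ := hsurj.hasRightInverse
    have hF : ∀ a, (F ∘ d) (r a) = F a := fun a => congrArg F (hr a)
    simp only [Function.comp_apply] at hF
    have heq : ∀ i j, d i = d j → v i = v j := fun i j hij =>
      (DiffSign.eq_iff_of_code_eq hv i j).2 (congrArg F hij)
    have him : ∀ a b : CellIndex β γ, a.1 = b.1 → (v (r a)).im = (v (r b)).im := by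
      intro a b hab
      refine le_antisymm (not_lt.1 fun h => ?_) (not_lt.1 fun h => ?_)
      · rw [← h1, Function.comp_apply, Function.comp_apply, hF, hF] at h
        simp [F, hab] at h
      · rw [← h1, Function.comp_apply, Function.comp_apply, hF, hF] at h
        simp [F, hab] at h
    -- Every row has a first point, from which its imaginary part is read off below.
    have hlen : ∀ j, 0 < (γ j).length := fun j =>
      (γ j).length_pos_of_pos (β.blocks_pos' j j.2)
    refine ⟨fun j => (v (r ⟨j, ⟨0, hlen j⟩⟩)).im, fun j k => (v (r ⟨j, k⟩)).re, ?_, ?_, ?_⟩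
    · intro i j hij
      rw [← h1, Function.comp_apply, Function.comp_apply, hF, hF]
      simpa [F] using hij
    · intro j k l hkl
      refine (h2 _ _ ?_).1 ?_
      · rw [Function.comp_apply, Function.comp_apply, hF, hF]
      · rw [Function.comp_apply, Function.comp_apply, hF, hF]
        simpa [F] using hkl
    · rw [← hproj]
      congr 2
      funext k
      have h3 : v k = v (r (d k)) := heq _ _ (hr _).symm
      exact h3.trans (Complex.ext rfl (him _ _ rfl))

theorem fnfStrata_eq (n : ℕ) : fnfStrata n = fnfSign.strata n := by
  ext S
  constructor
  · rintro ⟨β, γ, rfl⟩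
    obtain ⟨v, hv⟩ := exists_fnfCell_eq_stratum β γ
    exact ⟨v, hv.symm⟩
  · rintro ⟨v, rfl⟩
    obtain ⟨β, γ, h⟩ := exists_mem_fnfCell (proj ℂ n v)
    obtain ⟨w, hw⟩ := exists_fnfCell_eq_stratum β γ
    refine ⟨β, γ, ?_⟩
    rw [hw] at h ⊢
    exact DiffSign.stratum_eq_of_mem h

/-- The sign of the negative of the real part and, on the imaginary line, of the imaginary
part. -/
noncomputable def ifnfSign : DiffSign (SignType × SignType) :=
  lexSign (-Complex.reCLM) Complex.imCLM fun _ h1 h2 => Complex.ext (neg_eq_zero.1 h1) h2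

/-- Multiplication by `i` turns `im w` into minus the new real part and `re w` into the new
imaginary part. -/
theorem ifnfSign_sgn_I_mul (w : ℂ) : ifnfSign.sgn (Complex.I * w) = fnfSign.sgn w := by
  by_cases h : w.im = 0 <;> simp [ifnfSign, fnfSign, lexSign, h]

theorem ifnfSign_code_eq_iff {v w : Fin n → ℂ} :
    ifnfSign.code v = ifnfSign.code w ↔
      (∀ i j, (v i).re < (v j).re ↔ (w i).re < (w j).re) ∧
      (∀ i j, (v i).re = (v j).re → ((v i).im < (v j).im ↔ (w i).im < (w j).im)) := by
  refine (lexSign_code_eq_iff _ _ _).trans ?_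
  simp only [neg_apply, Complex.reCLM_apply, Complex.imCLM_apply, neg_inj,
    neg_lt_neg_iff]
  -- The negated real part reverses inequalities, which amounts to exchanging `i` and `j`.
  exact and_congr_left fun _ => forall_comm

theorem image_stratum_I_mul (v : Fin n → ℂ) :
    Sym.map (fun w : ℂ => Complex.I * w) '' fnfSign.stratum v =
      ifnfSign.stratum fun k => Complex.I * v k := by
  have hc : ∀ v : Fin n → ℂ, ifnfSign.code (fun k => Complex.I * v k) = fnfSign.code v := by
    intro v
    funext i j
    change ifnfSign.sgn _ = fnfSign.sgn _
    rw [← mul_sub, ifnfSign_sgn_I_mul]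
  ext z
  constructor
  · rintro ⟨_, ⟨w, hw, rfl⟩, rfl⟩
    rw [map_proj]
    exact ⟨_, ((hc w).trans hw).trans (hc v).symm, rfl⟩
  · rintro ⟨w, hw, rfl⟩
    have h1 : (fun w : ℂ => Complex.I * w) ∘ (fun k => -Complex.I * w k) = w := by
      funext k
      simp [← mul_assoc]
    refine ⟨proj ℂ n fun k => -Complex.I * w k, ⟨_, ?_, rfl⟩, by rw [map_proj, h1]⟩
    refine (hc _).symm.trans (Eq.trans ?_ (hc v))
    change ifnfSign.code ((fun w : ℂ => Complex.I * w) ∘ (fun k => -Complex.I * w k)) = _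
    rw [h1]
    exact hw

theorem ifnfStrata_eq (n : ℕ) : ifnfStrata n = ifnfSign.strata n := by
  ext S
  rw [ifnfStrata, fnfStrata_eq]
  constructor
  · rintro ⟨_, ⟨v, rfl⟩, rfl⟩
    exact ⟨_, (image_stratum_I_mul v).symm⟩
  · rintro ⟨v, rfl⟩
    refine ⟨_, ⟨fun k => -Complex.I * v k, rfl⟩, ?_⟩
    rw [image_stratum_I_mul]
    congr 1
    funext k
    simp [← mul_assoc]

end SymProd

namespace SymProd

open Topology Filter

/-! ### Comparison of the four decompositions -/

variable {n : ℕ}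

theorem refines_zeroSign {K : Type*} (s : DiffSign K) (n : ℕ) :
    Refines (s.strata n) (zeroSign.strata n) := by
  refine DiffSign.refines_strata fun w w' h => propext ?_
  change w = 0 ↔ w' = 0
  constructor
  · rintro rfl
    exact s.eq_zero _ h.symm
  · rintro rfl
    exact s.eq_zero _ h

theorem fnfSign_sgn_congr (w w' : ℂ) (h : contSign.sgn w = contSign.sgn w') :
    fnfSign.sgn w = fnfSign.sgn w' := by
  simp only [contSign, gridSign, Prod.mk.injEq, Complex.reCLM_apply, Complex.imCLM_apply] at h
  have h0 : w.im = 0 ↔ w'.im = 0 := by rw [← sign_eq_zero_iff, h.2, sign_eq_zero_iff]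
  simp only [fnfSign, lexSign, Complex.reCLM_apply, Complex.imCLM_apply, h.1, h.2, h0]
  congr

theorem ifnfSign_sgn_congr (w w' : ℂ) (h : contSign.sgn w = contSign.sgn w') :
    ifnfSign.sgn w = ifnfSign.sgn w' := by
  simp only [contSign, gridSign, Prod.mk.injEq, Complex.reCLM_apply, Complex.imCLM_apply] at h
  have h0 : w.re = 0 ↔ w'.re = 0 := by rw [← sign_eq_zero_iff, h.1, sign_eq_zero_iff]
  simp only [ifnfSign, lexSign, neg_apply, Complex.reCLM_apply, Complex.imCLM_apply,
    Left.sign_neg, neg_eq_zero, h.1, h.2, h0]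

theorem contMap_proj_congr {v w : Fin n → ℂ} (h : contSign.code v = contSign.code w) :
    contMap (proj ℂ n v) = contMap (proj ℂ n w) := by
  have h1 : proj ℂ n v ∈ contCell (contMap (proj ℂ n w)) := by
    rw [contCell_contMap_proj, ← DiffSign.stratum_congr h]
    exact DiffSign.proj_mem_stratum_self v
  exact h1

/-- The rank of the first component of a pair of signs. -/
def fstRank (k : SignType × SignType) : ℕ := if k.1 = 0 then 0 else 1

/-- The first components of the two lexicographic signs detect distinct imaginary and distinct real
parts, the two contributions to the grid rank. -/
theorem totalRank_contSign (v : Fin n → ℂ) : contSign.totalRank v =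
    (∑ i, ∑ j, fstRank (fnfSign.code v i j)) + ∑ i, ∑ j, fstRank (ifnfSign.code v i j) := by
  simp only [DiffSign.totalRank, ← Finset.sum_add_distrib]
  refine Finset.sum_congr rfl fun i _ => Finset.sum_congr rfl fun j _ => ?_
  simp only [fstRank, DiffSign.code, contSign, gridSign, fnfSign, ifnfSign, lexSign, neg_apply,
    Complex.reCLM_apply, Complex.imCLM_apply, Left.sign_neg, sign_eq_zero_iff]
  rw [add_comm]
  simp

/-- A connected set that lies in a cell of each of the two decompositions lies in a contingency
cell. -/
theorem contMap_eq_of_isPreconnected {T : Set (Sym ℂ n)} (hT : IsPreconnected T)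
    {a b : Fin n → ℂ} (ha : T ⊆ fnfSign.stratum a) (hb : T ⊆ ifnfSign.stratum b)
    {z z' : Sym ℂ n} (hz : z ∈ T) (hz' : z' ∈ T) : contMap z = contMap z' := by
  refine hT.induction₂ (fun z z' => contMap z = contMap z') ?_ (fun _ _ _ _ _ _ => Eq.trans)
    (fun _ _ _ _ => Eq.symm) hz hz'
  intro z hz
  obtain ⟨v, rfl⟩ := proj_surjective ℂ n z
  rw [eventually_nhdsWithin_iff, nhds_proj, eventually_map]
  filter_upwards [DiffSign.eventually_near (s := contSign) v] with w hw hwT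
  refine (contMap_proj_congr (hw.2 ?_)).symm
  -- Both summands are invariants of the cells containing `T`, so the rank is constant on `T`.
  have h1 : ∀ {u}, proj ℂ n u ∈ T → contSign.totalRank u =
      (∑ i, ∑ j, fstRank (fnfSign.code a i j)) + ∑ i, ∑ j, fstRank (ifnfSign.code b i j) :=
    fun {u} hu => by
      rw [totalRank_contSign, DiffSign.sum_code_eq_of_mem_stratum fstRank (ha hu),
        DiffSign.sum_code_eq_of_mem_stratum fstRank (hb hu)]
  rw [h1 hwT, h1 hz]

theorem refines_contStrata {𝒯 : Set (Set (Sym ℂ n))} (h𝒯 : HasConnectedStrata 𝒯)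
    (h1 : Refines 𝒯 (fnfSign.strata n)) (h2 : Refines 𝒯 (ifnfSign.strata n)) :
    Refines 𝒯 (contStrata n) := by
  intro T hT
  obtain ⟨_, ⟨a, rfl⟩, ha⟩ := h1 T hT
  obtain ⟨_, ⟨b, rfl⟩, hb⟩ := h2 T hT
  obtain ⟨⟨z, hz⟩, hc⟩ := h𝒯 T hT
  exact ⟨contCell (contMap z), ⟨_, rfl⟩,
    fun z' hz' => contMap_eq_of_isPreconnected hc ha hb hz' hz⟩

/-- A generic shear separates the real parts of distinct points. -/
theorem exists_shear (v : Fin n → ℂ) : ∃ t : ℝ, ∀ i j,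
    (v i).re + t * (v i).im = (v j).re + t * (v j).im → v i = v j := by
  have hfin : (⋃ i, ⋃ j, {t : ℝ | v i ≠ v j ∧
      (v i).re + t * (v i).im = (v j).re + t * (v j).im}).Finite := by
    -- For distinct points at most one value of `t` makes the sheared real parts agree.
    refine Set.finite_iUnion fun i => Set.finite_iUnion fun j => Set.Subsingleton.finite ?_
    rintro t ⟨hne, ht⟩ t' ⟨-, ht'⟩
    by_contra h
    have h1 : (t - t') * ((v i).im - (v j).im) = 0 := by linear_combination ht - ht'
    have h2 : (v i).im = (v j).im :=
      sub_eq_zero.1 ((mul_eq_zero.1 h1).resolve_left (sub_ne_zero.2 h))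
    refine hne (Complex.ext ?_ h2)
    rw [h2] at ht
    exact add_right_cancel ht
  obtain ⟨t, ht⟩ := hfin.exists_notMem
  refine ⟨t, fun i j h => ?_⟩
  by_contra hne
  exact ht (Set.mem_iUnion.2 ⟨i, Set.mem_iUnion.2 ⟨j, hne, h⟩⟩)

theorem fnfSign_code_shear (v : Fin n → ℂ) (t : ℝ) :
    fnfSign.code v = fnfSign.code fun k => (⟨(v k).re + t * (v k).im, (v k).im⟩ : ℂ) := by
  rw [fnfSign_code_eq_iff]
  refine ⟨fun i j => Iff.rfl, fun i j h => ?_⟩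
  simp [h]

/-- When each row carries a single point, real parts are never compared and may be replaced; the
next lemma is the dual statement for columns. -/
theorem fnfSign_code_congr_im {x x' y : Fin n → ℝ} (h : ∀ i j, y i = y j → x i = x j)
    (h' : ∀ i j, y i = y j → x' i = x' j) :
    fnfSign.code (fun k => (⟨x k, y k⟩ : ℂ)) = fnfSign.code fun k => (⟨x' k, y k⟩ : ℂ) := by
  rw [fnfSign_code_eq_iff]
  refine ⟨fun i j => Iff.rfl, fun i j hij => ?_⟩
  simp [h i j hij, h' i j hij]

theorem ifnfSign_code_congr_re {x y y' : Fin n → ℝ} (h : ∀ i j, x i = x j → y i = y j)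
    (h' : ∀ i j, x i = x j → y' i = y' j) :
    ifnfSign.code (fun k => (⟨x k, y k⟩ : ℂ)) = ifnfSign.code fun k => (⟨x k, y' k⟩ : ℂ) := by
  rw [ifnfSign_code_eq_iff]
  refine ⟨fun i j => Iff.rfl, fun i j hij => ?_⟩
  simp [h i j hij, h' i j hij]

/-- Points of one complex stratum are linked by moves inside the cells of the two
decompositions. -/
theorem rel_of_zeroSign_code_eq {E : (Fin n → ℂ) → (Fin n → ℂ) → Prop}
    (htrans : ∀ {u v w}, E u v → E v w → E u w)
    (h1 : ∀ {u v}, fnfSign.code u = fnfSign.code v → E u v)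
    (h2 : ∀ {u v}, ifnfSign.code u = ifnfSign.code v → E u v) {v w : Fin n → ℂ}
    (h : zeroSign.code v = zeroSign.code w) : E v w := by
  rw [zeroSign_code_eq_iff] at h
  obtain ⟨t, ht⟩ := exists_shear v
  obtain ⟨t', ht'⟩ := exists_shear w
  set x : Fin n → ℝ := fun k => (v k).re + t * (v k).im with hx
  set x' : Fin n → ℝ := fun k => (w k).re + t' * (w k).im with hx'
  have hxw : ∀ i j, x i = x j → w i = w j := fun i j hij => (h i j).1 (ht i j hij)
  have hxv : ∀ i j, x' i = x' j → v i = v j := fun i j hij => (h i j).2 (ht' i j hij)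
  have hx'x : ∀ i j, x' i = x' j → x i = x j := fun i j hij => by simp [hx, hxv i j hij]
  have hxx' : ∀ i j, x i = x j → x' i = x' j := fun i j hij => by simp [hx', hxw i j hij]
  -- The path is `v`, `(x, im v)`, `(x, x)`, `(x', x)`, `(x', im w)`, `w`. Both `x` and `x'` have
  -- exactly the coincidences of `v` and `w`.
  have e1 := h1 (fnfSign_code_shear v t)
  have e2 := h2 (ifnfSign_code_congr_re (x := x) (y := fun k => (v k).im) (y' := x)
    (fun i j hij => by simp [ht i j hij]) fun i j hij => hij)
  have e3 := h1 (fnfSign_code_congr_im (x := x) (y := x) (x' := x') (fun i j hij => hij) hxx')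
  have e4 := h2 (ifnfSign_code_congr_re (x := x') (y := x) (y' := fun k => (w k).im)
    hx'x fun i j hij => by simp [ht' i j hij])
  have e5 := h1 (fnfSign_code_shear w t').symm
  exact htrans e1 (htrans e2 (htrans e3 (htrans e4 e5)))

theorem zeroSign_refines {𝒯 : Set (Set (Sym ℂ n))} (h𝒯 : Setoid.IsPartition 𝒯)
    (h1 : Refines (fnfSign.strata n) 𝒯) (h2 : Refines (ifnfSign.strata n) 𝒯) :
    Refines (zeroSign.strata n) 𝒯 := by
  rintro _ ⟨v, rfl⟩
  obtain ⟨T, ⟨hT, hvT⟩, -⟩ := h𝒯.2 (proj ℂ n v)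
  refine ⟨T, hT, ?_⟩
  rintro _ ⟨w, hw, rfl⟩
  -- Since members of `𝒯` are disjoint, membership in one of them propagates along each stratum of
  -- `s`.
  have key : ∀ {K : Type} (s : DiffSign K), Refines (s.strata n) 𝒯 → ∀ {u v},
      s.code u = s.code v → ∀ T ∈ 𝒯, proj ℂ n u ∈ T → proj ℂ n v ∈ T := by
    intro K s hs u v huv T hT hu
    obtain ⟨T', hT', h⟩ := hs _ ⟨v, rfl⟩
    have hu' : proj ℂ n u ∈ T' := h ⟨u, huv, rfl⟩
    rw [(h𝒯.2 (proj ℂ n u)).unique ⟨hT, hu⟩ ⟨hT', hu'⟩]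
    exact h (DiffSign.proj_mem_stratum_self v)
  exact rel_of_zeroSign_code_eq
    (E := fun u v => ∀ T ∈ 𝒯, proj ℂ n u ∈ T → proj ℂ n v ∈ T)
    (fun h h' T hT hu => h' T hT (h T hT hu)) (key _ h1) (key _ h2)
    (Eq.symm hw) T hT hvT

end SymProd

namespace SymProd

open Topology Filter

/-! ### Anodyne contractions -/

variable {n p q : ℕ}

theorem DiffSign.stratum_eq_iff {K : Type*} {s : DiffSign K} {v w : Fin n → ℂ} :
    s.stratum v = s.stratum w ↔ ∃ σ : Equiv.Perm (Fin n), s.code (v ∘ σ) = s.code w := by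
  rw [← DiffSign.proj_mem_stratum]
  exact ⟨fun h => h ▸ DiffSign.proj_mem_stratum_self v, DiffSign.stratum_eq_of_mem⟩

/-- Each stratum of the finer `s'` sits in a unique stratum of `s`, the one with the same
representative. -/
theorem DiffSign.lieInSame_iff {K K' : Type*} {s : DiffSign K} {s' : DiffSign K'}
    (h : ∀ w w', s'.sgn w = s'.sgn w' → s.sgn w = s.sgn w') {v w : Fin n → ℂ} :
    LieInSame (s.strata n) (s'.stratum v) (s'.stratum w) ↔ s.stratum v = s.stratum w := by
  have hsub : ∀ v : Fin n → ℂ, s'.stratum v ⊆ s.stratum v := fun v =>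
    Set.image_mono fun w hw => funext fun i => funext fun j => h _ _ (congrFun (congrFun hw i) j)
  constructor
  · rintro ⟨S, hS, hv, hw⟩
    rw [← DiffSign.exists_eq_stratum hS (hv (DiffSign.proj_mem_stratum_self v)),
      ← DiffSign.exists_eq_stratum hS (hw (DiffSign.proj_mem_stratum_self w))]
  · intro hvw
    exact ⟨s.stratum v, ⟨v, rfl⟩, hsub v, hvw ▸ hsub w⟩

theorem zeroSign_sgn_congr (w w' : ℂ) (h : contSign.sgn w = contSign.sgn w') :
    zeroSign.sgn w = zeroSign.sgn w' := by
  refine propext ⟨?_, ?_⟩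
  · rintro rfl
    exact contSign.eq_zero _ h.symm
  · rintro rfl
    exact contSign.eq_zero _ h

/-- The points with coordinates `α k`, `β k`. -/
def gridPoints (α : Fin n → Fin p) (β : Fin n → Fin q) (k : Fin n) : ℂ :=
  ⟨((α k : ℕ) : ℝ), ((β k : ℕ) : ℝ)⟩

theorem contCell_ofMaps {α : Fin n → Fin p} {β : Fin n → Fin q} (hα : Function.Surjective α)
    (hβ : Function.Surjective β) :
    contCell ⟨p, q, CM.ofMaps α β hα hβ⟩ = contSign.stratum (gridPoints α β) :=
  contCell_eq_stratum (strictMono_val p) (strictMono_val q) hα hβ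

theorem gridPoints_eq_iff {α : Fin n → Fin p} {β : Fin n → Fin q} {i j : Fin n} :
    gridPoints α β i = gridPoints α β j ↔ α i = α j ∧ β i = β j := by
  simp [gridPoints, Complex.ext_iff, Fin.ext_iff]

theorem hContract_ofMaps {α : Fin n → Fin (p + 1)} {β : Fin n → Fin q}
    (hα : Function.Surjective α) (hβ : Function.Surjective β) (i : Fin p) :
    (CM.ofMaps α β hα hβ).hContract i =
      CM.ofMaps (i.predAbove ∘ α) β ((Fin.predAbove_surjective i).comp hα) hβ := by
  ext a j
  change ∑ k ∈ Finset.univ.filter (fun k => i.predAbove k = a),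
    (Finset.univ.filter fun l => α l = k ∧ β l = j).card =
    (Finset.univ.filter fun l => i.predAbove (α l) = a ∧ β l = j).card
  rw [Finset.card_eq_sum_card_fiberwise (f := α)
    (t := Finset.univ.filter fun k => i.predAbove k = a)]
  · refine Finset.sum_congr rfl fun k hk => ?_
    rw [Finset.filter_filter]
    congr 1
    ext l
    simp only [Finset.mem_filter, Finset.mem_univ, true_and] at hk ⊢
    constructor
    · rintro ⟨rfl, h⟩
      exact ⟨⟨hk, h⟩, rfl⟩
    · rintro ⟨⟨-, h⟩, rfl⟩
      exact ⟨rfl, h⟩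
  · intro l hl
    simp only [Finset.coe_filter, Finset.mem_univ, true_and, Set.mem_ofPred_eq] at hl ⊢
    exact hl.1

/-- If `w` is obtained from `v` by identifications and lies in the same complex stratum, then no
points are identified. -/
theorem eq_of_zeroSign_stratum_eq {v w : Fin n → ℂ}
    (h : zeroSign.stratum v = zeroSign.stratum w) (hvw : ∀ i j, v i = v j → w i = w j)
    (i j : Fin n) (hij : w i = w j) : v i = v j := by
  classical
  -- Summing `φ` counts coinciding pairs, an invariant of the complex stratum; identifications can
  -- only increase each term.
  let φ : Prop → ℕ := fun k => if k then 1 else 0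
  have hsum := DiffSign.sum_code_eq_of_mem_stratum (s := zeroSign) φ
    (h ▸ DiffSign.proj_mem_stratum_self v)
  have hle : ∀ i j, φ (zeroSign.code v i j) ≤ φ (zeroSign.code w i j) := fun i j => by
    by_cases hv : v i = v j
    · simp [φ, DiffSign.code, zeroSign, hv, hvw i j hv]
    · simp [φ, DiffSign.code, zeroSign, sub_eq_zero, hv]
  have h1 := (Finset.sum_eq_sum_iff_of_le (s := Finset.univ) (fun i _ =>
    Finset.sum_le_sum fun j _ => hle i j)).1 hsum i (Finset.mem_univ i)
  have h2 := (Finset.sum_eq_sum_iff_of_le (s := Finset.univ) (fun j _ => hle i j)).1 h1 j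
    (Finset.mem_univ j)
  by_contra hv
  simp [φ, DiffSign.code, zeroSign, sub_eq_zero, hij, hv] at h2

theorem fnfSign_code_gridPoints_comp {p' : ℕ} {α : Fin n → Fin p} {β : Fin n → Fin q}
    {π : Fin p → Fin p'} (hπ : Monotone π)
    (hinj : ∀ i j, β i = β j → π (α i) = π (α j) → α i = α j) :
    fnfSign.code (gridPoints α β) = fnfSign.code (gridPoints (π ∘ α) β) := by
  rw [fnfSign_code_eq_iff]
  refine ⟨fun i j => Iff.rfl, fun i j h => ?_⟩
  have hβ : β i = β j := by simpa [gridPoints, Fin.ext_iff] using h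
  simp only [gridPoints, Nat.cast_lt, Fin.val_fin_lt, Function.comp_apply]
  constructor
  · intro h
    exact lt_of_le_of_ne (hπ h.le) fun h' => h.ne (hinj i j hβ h')
  · intro h
    exact lt_of_not_ge fun h' => (hπ h').not_gt h

/-- Staying in the complex stratum forbids merging points, so the contraction is injective on each
row and keeps its order. -/
theorem lieInSame_fnfStrata_of_horAnodyne {M N : CMn n} (h : HorAnodyne M N) :
    LieInSame (fnfStrata n) (contCell M) (contCell N) := by
  obtain ⟨M, i, h⟩ := h
  obtain ⟨α, β, hα, hβ, rfl⟩ := exists_ofMaps M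
  rw [hContract_ofMaps] at h ⊢
  rw [complexStrata_eq, contCell_ofMaps, contCell_ofMaps,
    DiffSign.lieInSame_iff zeroSign_sgn_congr] at h
  rw [fnfStrata_eq, contCell_ofMaps, contCell_ofMaps, DiffSign.lieInSame_iff fnfSign_sgn_congr]
  refine DiffSign.stratum_congr
    (fnfSign_code_gridPoints_comp (Fin.predAbove_right_monotone i) fun k l hkl h' => ?_)
  refine (gridPoints_eq_iff.1 (eq_of_zeroSign_stratum_eq h (fun k l hkl => ?_) k l
    (gridPoints_eq_iff.2 ⟨h', hkl⟩))).1
  obtain ⟨h1, h2⟩ := gridPoints_eq_iff.1 hkl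
  exact gridPoints_eq_iff.2 ⟨congrArg i.predAbove h1, h2⟩

theorem lieInSame_equivalence {K : Type*} {s : DiffSign K}
    (h : ∀ w w', contSign.sgn w = contSign.sgn w' → s.sgn w = s.sgn w') :
    Equivalence fun M N : CMn n => LieInSame (s.strata n) (contCell M) (contCell N) := by
  choose v hv using exists_contCell_eq_stratum (n := n)
  simp only [hv, DiffSign.lieInSame_iff h]
  exact ⟨fun _ => rfl, Eq.symm, Eq.trans⟩

theorem succAbove_predAbove {p : ℕ} {X : Type*} (π : Fin (p + 1) → X) {i : Fin p}
    (hi : π i.castSucc = π i.succ) (k : Fin (p + 1)) :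
    π (i.succ.succAbove (i.predAbove k)) = π k := by
  by_cases h : k = i.succ
  · subst h
    rw [Fin.predAbove_succ_self, Fin.succAbove_succ_self, hi]
  · rw [Fin.succ_succAbove_predAbove h]

/-- A monotone merging of columns which merges no points is a chain of anodyne contractions. -/
theorem eqvGen_horAnodyne_comp {p' : ℕ} (β : Fin n → Fin q) (hβ : Function.Surjective β)
    (α : Fin n → Fin p) (hα : Function.Surjective α)
    (π : Fin p → Fin p') (hπ : Monotone π) (hπs : Function.Surjective π)
    (hinj : ∀ i j, β i = β j → π (α i) = π (α j) → α i = α j) :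
    Relation.EqvGen HorAnodyne ⟨p, q, CM.ofMaps α β hα hβ⟩
      ⟨p', q, CM.ofMaps (π ∘ α) β (hπs.comp hα) hβ⟩ := by
  induction p with
  | zero =>
    have hp : p' = 0 := by
      by_contra h
      exact (hπs ⟨0, Nat.pos_of_ne_zero h⟩).choose.elim0
    subst hp
    obtain rfl : π = id := funext fun i => i.elim0
    exact Relation.EqvGen.refl _
  | succ p ih =>
    -- Either two adjacent columns are merged and can be contracted first, or `π` is a strictly
    -- increasing bijection, hence the identity.
    by_cases h : ∃ i : Fin p, π i.castSucc = π i.succ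
    · obtain ⟨i, hi⟩ := h
      have key := succAbove_predAbove π hi
      have hcomp : π ∘ α = (π ∘ i.succ.succAbove) ∘ (i.predAbove ∘ α) :=
        funext fun k => (key (α k)).symm
      have hstep : HorAnodyne ⟨p + 1, q, CM.ofMaps α β hα hβ⟩
          ⟨p, q, CM.ofMaps (i.predAbove ∘ α) β ((Fin.predAbove_surjective i).comp hα) hβ⟩ := by
        rw [← hContract_ofMaps]
        refine HorAnodyne.intro _ i ?_
        rw [hContract_ofMaps, complexStrata_eq, contCell_ofMaps, contCell_ofMaps,
          DiffSign.lieInSame_iff zeroSign_sgn_congr]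
        refine DiffSign.stratum_congr (zeroSign_code_eq_iff.2 fun k l => ?_)
        rw [gridPoints_eq_iff, gridPoints_eq_iff]
        refine and_congr_left fun hkl => ⟨congrArg i.predAbove, fun h' => hinj k l hkl ?_⟩
        rw [← key, ← key (α l)]
        exact congrArg (fun a => π (i.succ.succAbove a)) h'
      refine Relation.EqvGen.trans _ _ _ (Relation.EqvGen.rel _ _ hstep) ?_
      have := ih (i.predAbove ∘ α) ((Fin.predAbove_surjective i).comp hα)
        (π ∘ i.succ.succAbove) (hπ.comp (Fin.strictMono_succAbove _).monotone)
        (fun b => by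
          obtain ⟨a, rfl⟩ := hπs b
          exact ⟨_, key a⟩)
        (fun k l hkl h' => congrArg i.predAbove (hinj k l hkl (by
          rw [← key, ← key (α l)]
          exact h')))
      simp only [← hcomp] at this
      exact this
    · push Not at h
      have hmono : StrictMono π := Fin.strictMono_iff_lt_succ.2 fun i =>
        lt_of_le_of_ne (hπ (Fin.castSucc_lt_succ).le) (h i)
      have hp : p + 1 = p' := by
        simpa using Fintype.card_of_bijective ⟨hmono.injective, hπs⟩
      subst hp
      obtain rfl : π = id := congrArg DFunLike.coe (Subsingleton.elim
        (hmono.orderIsoOfSurjective π hπs) (OrderIso.refl _))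
      exact Relation.EqvGen.refl _

/-- Column indices of `v` are a monotone function of those of `w`; the common code ensures that this
merging of columns identifies no points. -/
theorem eqvGen_horAnodyne_of_degeneration {v w : Fin n → ℂ} (hc : fnfSign.code v = fnfSign.code w)
    (hre : ∀ i j, (v i).re < (v j).re → (w i).re < (w j).re) :
    Relation.EqvGen HorAnodyne (contMap (proj ℂ n w)) (contMap (proj ℂ n v)) := by
  have heq := DiffSign.eq_iff_of_code_eq hc
  obtain ⟨p', q, x', y', α', β, hx', hy', hα', hβ, rfl⟩ := exists_ranks w
  obtain ⟨y, hy, hyv⟩ := exists_strictMono_factor (a := fun k => y' (β k))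
    (fun i j => ((fnfSign_code_eq_iff.1 hc).1 i j).symm) hy' hβ fun _ => rfl
  obtain ⟨p, x, α, hx, hα, hxv⟩ := exists_rank fun k => (v k).re
  obtain ⟨r, hr⟩ := hα'.hasRightInverse
  simp only at hre heq
  have hle : ∀ i j, α' i ≤ α' j → α i ≤ α j := fun i j hij => by
    refine not_lt.1 fun h => ?_
    have h1 := hre j i (by rw [hxv, hxv]; exact hx h)
    exact (hx'.lt_iff_lt.1 h1).not_ge hij
  have hαα : α = (fun a => α (r a)) ∘ α' := funext fun k =>
    le_antisymm (hle _ _ (hr _).ge) (hle _ _ (hr _).le)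
  have hv : v = fun k => (⟨x (α k), y (β k)⟩ : ℂ) :=
    funext fun k => Complex.ext (hxv k) (hyv k)
  have key := eqvGen_horAnodyne_comp β hβ α' hα' (fun a => α (r a))
    (fun a b hab => hle _ _ (by rwa [hr, hr]))
    (fun a => by
      obtain ⟨k, rfl⟩ := hα a
      exact ⟨α' k, (congrFun hαα k).symm⟩)
    (fun i j hij h => by
      have h1 : α i = α j := by
        rw [hαα]
        exact h
      have h2 := (heq i j).1 (by rw [hv]; simp only [h1, hij])
      exact hx'.injective (congrArg Complex.re h2))
  rw [hv, contMap_proj hx' hy' hα' hβ, contMap_proj hx hy hα hβ]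
  simp only [← hαα] at key
  exact key

/-- The face is connected, so the relation need only be checked near each point. There strict
inequalities of real parts persist, so the centre is a degeneration of its neighbours. -/
theorem eqvGen_horAnodyne_of_fnfSign_code_eq {v w : Fin n → ℂ}
    (h : fnfSign.code v = fnfSign.code w) :
    Relation.EqvGen HorAnodyne (contMap (proj ℂ n v)) (contMap (proj ℂ n w)) := by
  have hpre : IsPreconnected (fnfSign.face w) :=
    (DiffSign.convex_face (convex_lexSign _ _ _) w).isPreconnected
  refine hpre.induction₂
    (fun v w => Relation.EqvGen HorAnodyne (contMap (proj ℂ n v)) (contMap (proj ℂ n w)))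
    (fun u hu => ?_) (fun _ _ _ _ _ _ => Relation.EqvGen.trans _ _ _)
    (fun _ _ _ _ => Relation.EqvGen.symm _ _) h rfl
  have hev : ∀ᶠ u' : Fin n → ℂ in 𝓝 u, ∀ i j, (u i).re < (u j).re → (u' i).re < (u' j).re := by
    refine eventually_all.2 fun i => eventually_all.2 fun j => ?_
    by_cases hij : (u i).re < (u j).re
    · have h1 : ContinuousAt (fun u : Fin n → ℂ => (u i).re) u :=
        Continuous.continuousAt (by fun_prop)
      have h2 : ContinuousAt (fun u : Fin n → ℂ => (u j).re) u :=
        Continuous.continuousAt (by fun_prop)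
      filter_upwards [h1.eventually_lt h2 hij] with u' hu' _
      exact hu'
    · simp [hij]
  rw [eventually_nhdsWithin_iff]
  filter_upwards [hev] with u' hu' hface
  exact (eqvGen_horAnodyne_of_degeneration (Eq.trans hu (Eq.symm hface)) hu').symm

theorem eqvGen_horAnodyne_iff (M N : CMn n) : Relation.EqvGen HorAnodyne M N ↔
    LieInSame (fnfStrata n) (contCell M) (contCell N) := by
  have he : Equivalence fun M N : CMn n => LieInSame (fnfStrata n) (contCell M) (contCell N) := by
    rw [fnfStrata_eq]
    exact lieInSame_equivalence fnfSign_sgn_congr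
  constructor
  · intro h
    exact he.eqvGen_iff.1 (h.mono fun _ _ => lieInSame_fnfStrata_of_horAnodyne)
  · intro h
    have hM : ∀ M : CMn n, ∃ v : Fin n → ℂ, contMap (proj ℂ n v) = M := fun M => by
      obtain ⟨v, hv⟩ := exists_contCell_eq_stratum M
      have h : proj ℂ n v ∈ contCell M := hv ▸ DiffSign.proj_mem_stratum_self v
      exact ⟨v, h⟩
    obtain ⟨v, rfl⟩ := hM M
    obtain ⟨w, rfl⟩ := hM N
    rw [fnfStrata_eq, contCell_contMap_proj, contCell_contMap_proj,
      DiffSign.lieInSame_iff fnfSign_sgn_congr, DiffSign.stratum_eq_iff] at h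
    obtain ⟨σ, hσ⟩ := h
    rw [← proj_comp_perm v σ]
    exact eqvGen_horAnodyne_of_fnfSign_code_eq hσ

/-! ### Transposition -/

/-- The transpose of a contingency matrix. -/
def CM.transpose (M : CM n p q) : CM n q p where
  m j i := M.m i j
  col_ne := M.row_ne
  row_ne := M.col_ne
  weight := by
    rw [Finset.sum_comm]
    exact M.weight

/-- The transpose of a contingency matrix of any size. -/
def CMn.transpose (M : CMn n) : CMn n := ⟨M.2.1, M.1, M.2.2.transpose⟩

theorem transpose_ofMaps {α : Fin n → Fin p} {β : Fin n → Fin q} (hα : Function.Surjective α)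
    (hβ : Function.Surjective β) :
    (CM.ofMaps α β hα hβ).transpose = CM.ofMaps β α hβ hα := by
  ext j i
  change (Finset.univ.filter fun k => α k = i ∧ β k = j).card =
    (Finset.univ.filter fun k => β k = j ∧ α k = i).card
  simp only [and_comm]

/-- On grid points transposition exchanges the coordinates, so only codes of grid points have to be
compared. -/
theorem lieInSame_transpose_of {K K' : Type*} {s : DiffSign K} {s' : DiffSign K'}
    (hs : ∀ w w', contSign.sgn w = contSign.sgn w' → s.sgn w = s.sgn w')
    (hs' : ∀ w w', contSign.sgn w = contSign.sgn w' → s'.sgn w = s'.sgn w')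
    (h : ∀ {p q p' q' : ℕ} (α : Fin n → Fin p) (β : Fin n → Fin q) (α' : Fin n → Fin p')
      (β' : Fin n → Fin q'), s.code (gridPoints α β) = s.code (gridPoints α' β') ↔
        s'.code (gridPoints β α) = s'.code (gridPoints β' α')) (M N : CMn n) :
    LieInSame (s.strata n) (contCell M) (contCell N) ↔
      LieInSame (s'.strata n) (contCell M.transpose) (contCell N.transpose) := by
  obtain ⟨p, q, M⟩ := M
  obtain ⟨p', q', N⟩ := N
  obtain ⟨α, β, hα, hβ, rfl⟩ := exists_ofMaps M
  obtain ⟨α', β', hα', hβ', rfl⟩ := exists_ofMaps N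
  simp only [CMn.transpose, transpose_ofMaps, contCell_ofMaps]
  rw [DiffSign.lieInSame_iff hs, DiffSign.lieInSame_iff hs', DiffSign.stratum_eq_iff,
    DiffSign.stratum_eq_iff]
  exact exists_congr fun σ => h (α ∘ σ) (β ∘ σ) α' β'

theorem lieInSame_complexStrata_transpose (M N : CMn n) :
    LieInSame (complexStrata n) (contCell M) (contCell N) ↔
      LieInSame (complexStrata n) (contCell M.transpose) (contCell N.transpose) := by
  rw [complexStrata_eq]
  refine lieInSame_transpose_of zeroSign_sgn_congr zeroSign_sgn_congr (fun α β α' β' => ?_) M N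
  simp only [zeroSign_code_eq_iff, gridPoints_eq_iff, and_comm]

theorem lieInSame_ifnfStrata_transpose (M N : CMn n) :
    LieInSame (ifnfStrata n) (contCell M) (contCell N) ↔
      LieInSame (fnfStrata n) (contCell M.transpose) (contCell N.transpose) := by
  rw [fnfStrata_eq, ifnfStrata_eq]
  refine lieInSame_transpose_of ifnfSign_sgn_congr fnfSign_sgn_congr (fun α β α' β' => ?_) M N
  rw [ifnfSign_code_eq_iff, fnfSign_code_eq_iff]
  rfl

theorem horAnodyne_transpose {M N : CMn n} (h : VertAnodyne M N) :
    HorAnodyne M.transpose N.transpose := by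
  obtain ⟨M, j, h⟩ := h
  -- The transpose of `vContract` is `hContract` of the transpose by definition.
  exact HorAnodyne.intro M.transpose j ((lieInSame_complexStrata_transpose _ _).1 h)

theorem vertAnodyne_transpose {M N : CMn n} (h : HorAnodyne M N) :
    VertAnodyne M.transpose N.transpose := by
  obtain ⟨M, j, h⟩ := h
  exact VertAnodyne.intro M.transpose j ((lieInSame_complexStrata_transpose _ _).1 h)

theorem eqvGen_transpose {r r' : CMn n → CMn n → Prop}
    (h : ∀ {M N}, r M N → r' M.transpose N.transpose) {M N : CMn n}
    (hMN : Relation.EqvGen r M N) : Relation.EqvGen r' M.transpose N.transpose := by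
  induction hMN with
  | rel _ _ hr => exact .rel _ _ (h hr)
  | refl _ => exact .refl _
  | symm _ _ _ ih => exact ih.symm
  | trans _ _ _ _ _ ih ih' => exact ih.trans _ _ _ ih'

theorem eqvGen_vertAnodyne_iff (M N : CMn n) : Relation.EqvGen VertAnodyne M N ↔
    LieInSame (ifnfStrata n) (contCell M) (contCell N) := by
  rw [lieInSame_ifnfStrata_transpose, ← eqvGen_horAnodyne_iff]
  exact ⟨eqvGen_transpose horAnodyne_transpose, eqvGen_transpose vertAnodyne_transpose⟩

end SymProd

theorem theorem5p3 (n : ℕ) :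
    -- the four decompositions are stratifications
    (IsStratification (fnfStrata n) ∧ IsStratification (ifnfStrata n) ∧
      IsStratification (contStrata n) ∧ IsStratification (complexStrata n)) ∧
    -- (a) the contingency stratification has connected strata and refines both decompositions,
    -- and every partition into connected sets (in particular, every stratification with connected
    -- strata) that refines both of them refines the contingency stratification
    (HasConnectedStrata (contStrata n) ∧
      Refines (contStrata n) (fnfStrata n) ∧ Refines (contStrata n) (ifnfStrata n) ∧
      ∀ 𝒯 : Set (Set (Sym ℂ n)), Setoid.IsPartition 𝒯 → HasConnectedStrata 𝒯 →
        Refines 𝒯 (fnfStrata n) → Refines 𝒯 (ifnfStrata n) → Refines 𝒯 (contStrata n)) ∧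
    -- (b) both decompositions refine the complex stratification, and the complex stratification
    -- refines every partition (in particular, every stratification) refined by both of them
    (Refines (fnfStrata n) (complexStrata n) ∧ Refines (ifnfStrata n) (complexStrata n) ∧
      ∀ 𝒯 : Set (Set (Sym ℂ n)), Setoid.IsPartition 𝒯 →
        Refines (fnfStrata n) 𝒯 → Refines (ifnfStrata n) 𝒯 → Refines (complexStrata n) 𝒯) ∧
    -- (c) the cells related by chains of anodyne horizontal (vertical) contractions, in either
    -- direction, are those in the same cell of the first (second) decomposition
    (∀ M N : CMn n, Relation.EqvGen HorAnodyne M N ↔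
      LieInSame (fnfStrata n) (contCell M) (contCell N)) ∧
    (∀ M N : CMn n, Relation.EqvGen VertAnodyne M N ↔
      LieInSame (ifnfStrata n) (contCell M) (contCell N)) := by
  refine ⟨⟨?_, ?_, ?_, ?_⟩, ⟨?_, ?_, ?_, ?_⟩, ⟨?_, ?_, ?_⟩, eqvGen_horAnodyne_iff,
    eqvGen_vertAnodyne_iff⟩
  · rw [fnfStrata_eq]
    exact DiffSign.isStratification_strata
  · rw [ifnfStrata_eq]
    exact DiffSign.isStratification_strata
  · rw [contStrata_eq]
    exact DiffSign.isStratification_strata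
  · rw [complexStrata_eq]
    exact DiffSign.isStratification_strata
  · rw [contStrata_eq]
    rintro _ ⟨v, rfl⟩
    exact DiffSign.isConnected_stratum (convex_gridSign _ _ _) v
  · rw [contStrata_eq, fnfStrata_eq]
    exact DiffSign.refines_strata fnfSign_sgn_congr
  · rw [contStrata_eq, ifnfStrata_eq]
    exact DiffSign.refines_strata ifnfSign_sgn_congr
  · intro 𝒯 _ h𝒯 h1 h2
    rw [fnfStrata_eq] at h1
    rw [ifnfStrata_eq] at h2
    exact refines_contStrata h𝒯 h1 h2
  · rw [fnfStrata_eq, complexStrata_eq]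
    exact refines_zeroSign _ n
  · rw [ifnfStrata_eq, complexStrata_eq]
    exact refines_zeroSign _ n
  · intro 𝒯 h𝒯 h1 h2
    rw [fnfStrata_eq] at h1
    rw [ifnfStrata_eq] at h2
    rw [complexStrata_eq]
    exact zeroSign_refines h𝒯 h1 h2
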